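/- Let $\mathscr{A}$ be a set (the alphabet), let $F$ be a set of finite words over $\mathscr{A}$, and let $X\subseteq\mathscr{A}^{\mathbb N}$ be the subshift of all sequences in which no word of $F$ occurs as a block of consecutive letters. Let $\mathcal{L}_X$ be the language of $X$, i.e. the set of finite words (including the empty word $\omega$) occurring in sequences of $X$, and assume that every letter of $\mathscr{A}$ occurs in some sequence of $X$. For $\alpha,\beta\in\mathcal{L}_X$ put $C(\alpha,\beta)=\{\beta x\in X:\alpha x\in X\}$, and let $\mathcal{U}$ be the Boolean algebra of subsets of $X$ generated by all the sets $C(\alpha,\beta)$, $\alpha,\beta\in\mathcal{L}_X$. For a commutative unital ring $R$, let $\widetilde{\mathcal A}_R(X)$ be the universal unital $R$-algebra with generators $\{p_A:A\in\mathcal{U}\}$ and $\{s_a,s_a^*:a\in\mathscr{A}\}$ subject to the relations (i) $p_X=1$, $p_{A\cap B}=p_Ap_B$, $p_{A\cup B}=p_A+p_B-p_{A\cap B}$ and $p_\emptyset=0$ for all $A,B\in\mathcal{U}$; (ii) $s_as_a^*s_a=s_a$ and $s_a^*s_as_a^*=s_a^*$ for all $a\in\mathscr{A}$; (iii) $s_\beta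 s_\alpha^*s_\alpha s_\beta^*=p_{C(\alpha,\beta)}$ for all $\alpha,\beta\in\mathcal{L}_X$, where $s_\omega=s_\omega^*=1$, $s_\alpha=s_{\alpha_1}\cdots s_{\alpha_n}$ and $s_\alpha^*=s_{\alpha_n}^*\cdots s_{\alpha_1}^*$ for $\alpha=\alpha_1\cdots\alpha_n$. Let $\mathcal{Q}_X$ be the set of irrational paths, i.e. of the one-point sets $\{p\}\in\mathcal{U}$ such that $p\neq\alpha\beta^\infty$ for all $\alpha,\beta\in\mathcal{L}_X$ with $\beta\neq\omega$. Suppose that $R$ is a field and let $I$ be a left ideal of $\widetilde{\mathcal A}_R(X)$. Then $I$ is minimal (that is, $I\neq 0$ and the only left ideal strictly contained in $I$ is $0$) if and only if $I$ is isomorphic, as a left $\widetilde{\mathcal A}_R(X)$-module, to $\widetilde{\mathcal A}_R(X)p_A$ for some $A\in\mathcal{Q}_X$. -/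

import Mathlib

namespace SubshiftAlgebra

universe u v

/-- The subshift of all sequences over the alphabet `𝒜`, none of whose words (finite blocks of
consecutive letters) belongs to the set `F` of forbidden words. -/
def subshift {𝒜 : Type v} (F : Set (List 𝒜)) : Set (Stream' 𝒜) :=
  {x | ∀ k n : ℕ, (x.drop k).take n ∉ F}

/-- The language of `X`: the words `w` that are the initial word of some sequence in `X`.
For a shift-invariant `X` these are the words that occur anywhere in a sequence of `X`. -/
def language {𝒜 : Type v} (X : Set (Stream' 𝒜)) : Set (List 𝒜) :=
  {w | ∃ x ∈ X, x.take w.length = w}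

/-- `C(α, β) = {βx ∈ X : αx ∈ X}`, as a subset of `X`. -/
def C {𝒜 : Type v} (X : Set (Stream' 𝒜)) (α β : List 𝒜) : Set X :=
  {y | ∃ x : Stream' 𝒜, (y : Stream' 𝒜) = β ++ₛ x ∧ α ++ₛ x ∈ X}

/-- The Boolean algebra of subsets of `X` generated by the sets `C(α, β)`, for `α` and `β` in
the language of `X`. -/
def U {𝒜 : Type v} (X : Set (Stream' 𝒜)) : BooleanSubalgebra (Set X) :=
  BooleanSubalgebra.closure {A | ∃ α ∈ language X, ∃ β ∈ language X, A = C X α β}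

theorem C_mem_U {𝒜 : Type v} (X : Set (Stream' 𝒜)) {α β : List 𝒜}
    (hα : α ∈ language X) (hβ : β ∈ language X) : C X α β ∈ U X :=
  BooleanSubalgebra.subset_closure ⟨α, hα, β, hβ, rfl⟩

/-- The irrational paths of `X`: the elements of `U X` of the form `{p}` where `p` is
not of the form `αβ^∞` with `α, β` in the language of `X` (and `β` nonempty, so that the
infinite word `β^∞` makes sense). -/
def irrationalPaths {𝒜 : Type v} (X : Set (Stream' 𝒜)) : Set (U X) :=
  {A | ∃ p : X, (A : Set X) = {p} ∧
    ∀ α ∈ language X, ∀ β ∈ language X, ∀ hβ : β ≠ [],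
      (p : Stream' 𝒜) ≠ α ++ₛ Stream'.cycle β hβ}

/-- The generators `p_A` (`A ∈ U X`), `s_a` and `s_a^*` (`a` a letter). -/
inductive Generator {𝒜 : Type v} (X : Set (Stream' 𝒜)) : Type v
  | p (A : U X) : Generator X
  | s (a : 𝒜) : Generator X
  | sStar (a : 𝒜) : Generator X

section Free

variable (R : Type u) [CommRing R] {𝒜 : Type v} (X : Set (Stream' 𝒜))

/-- `p_A` in the free algebra. -/
def freeP (A : U X) : FreeAlgebra R (Generator X) := FreeAlgebra.ι R (Generator.p A)

/-- `s_a` in the free algebra. -/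
def freeS (a : 𝒜) : FreeAlgebra R (Generator X) := FreeAlgebra.ι R (Generator.s a)

/-- `s_a^*` in the free algebra. -/
def freeSStar (a : 𝒜) : FreeAlgebra R (Generator X) := FreeAlgebra.ι R (Generator.sStar a)

/-- `s_α = s_{α₁} ⋯ s_{αₙ}`, which is `1` for the empty word. -/
def freeSWord (α : List 𝒜) : FreeAlgebra R (Generator X) := (α.map (freeS R X)).prod

/-- `s_α^* = s_{αₙ}^* ⋯ s_{α₁}^*`, which is `1` for the empty word. -/
def freeSStarWord (α : List 𝒜) : FreeAlgebra R (Generator X) :=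
  (α.reverse.map (freeSStar R X)).prod

/-- The defining relations of the unital subshift algebra. -/
inductive Rel : FreeAlgebra R (Generator X) → FreeAlgebra R (Generator X) → Prop
  | p_top : Rel (freeP R X ⊤) 1
  | p_inter (A B : U X) : Rel (freeP R X (A ⊓ B)) (freeP R X A * freeP R X B)
  | p_union (A B : U X) :
      Rel (freeP R X (A ⊔ B)) (freeP R X A + freeP R X B - freeP R X (A ⊓ B))
  | p_bot : Rel (freeP R X ⊥) 0
  | s_sStar_s (a : 𝒜) : Rel (freeS R X a * freeSStar R X a * freeS R X a) (freeS R X a)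
  | sStar_s_sStar (a : 𝒜) :
      Rel (freeSStar R X a * freeS R X a * freeSStar R X a) (freeSStar R X a)
  | word (α β : List 𝒜) (hα : α ∈ language X) (hβ : β ∈ language X) :
      Rel (freeSWord R X β * freeSStarWord R X α * freeSWord R X α * freeSStarWord R X β)
        (freeP R X ⟨C X α β, C_mem_U X hα hβ⟩)

end Free

/-- The unital subshift algebra: the universal unital `R`-algebra with generators
`p_A`, `s_a`, `s_a^*` subject to the relations `Rel`. -/
abbrev UnitalSubshiftAlgebra (R : Type u) [CommRing R] {𝒜 : Type v}
    (X : Set (Stream' 𝒜)) : Type (max u v) :=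
  RingQuot (Rel R X)

/-- The element `p_A` of the unital subshift algebra. -/
def p (R : Type u) [CommRing R] {𝒜 : Type v} (X : Set (Stream' 𝒜)) (A : U X) :
    UnitalSubshiftAlgebra R X :=
  RingQuot.mkAlgHom R (Rel R X) (freeP R X A)

end SubshiftAlgebra

/-! Write Ã for the algebra. Everything rests on a reduction
(`exists_mul_mul_eq_smul_p_or_periodic`): every nonzero x has a two-sided multiple axb that is
either a nonzero scalar multiple of some p_D with D nonempty, or an element f = p_A f with A = {y},
y = γy for a nonempty word γ, and nonzero diagonal coefficient at y. Coefficients are read off in a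
representation on functions X → R[T;T⁻¹] in which s_α carries the weight T^|α|. When A = {y}, the
diagonal coefficient at y is multiplicative across p_A (`coeffAt_mul_p_mul`).

Let I be minimal and 0 ≠ x ∈ I. Right multiplication by b gives I ≅ Ã(axb). The periodic alternative
is impossible: f would be a left multiple of p_A(1 - s_γ)f, and comparing coefficients would make 1
- T^|γ| invertible (`not_isAtom_span_of_periodic`). So I ≅ Ãp_D. A cylinder cutting D properly would
give a smaller nonzero ideal, so D = {y}. If y were αβ^∞, compressing p_D by s_α would lead back to
the periodic case.

Conversely, if A = {y} is irrational, then αx = y = βx forces α = β, so p_A Ã p_A = R p_A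
(`p_mul_mul_p_eq_smul`). The reduction also shows that Ã is semiprime (`exists_mul_mul_ne_zero`).
Together these put p_A into every nonzero left ideal contained in Ãp_A. -/

namespace SubshiftAlgebra

universe u v

/-! ### Combinatorics of words and sequences. -/

section Words

variable {𝒜 : Type v}

/-- A set of sequences which is closed under the shift and in which every letter occurs. -/
class IsShiftSpace (X : Set (Stream' 𝒜)) : Prop where
  tail_mem : ∀ x ∈ X, x.tail ∈ X
  letter_mem : ∀ a : 𝒜, [a] ∈ language X

theorem subshift_isShiftSpace (F : Set (List 𝒜))
    (hF : ∀ a : 𝒜, [a] ∈ language (subshift F)) : IsShiftSpace (subshift F) where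
  tail_mem x hx k n := by
    have := hx (k + 1) n
    rwa [← Stream'.drop_tail'] at this
  letter_mem := hF

variable {X : Set (Stream' 𝒜)}

theorem take_append_length (α : List 𝒜) (x : Stream' 𝒜) : (α ++ₛ x).take α.length = α := by
  rw [Stream'.take_append_of_le_length _ _ _ le_rfl, List.take_length]

theorem mem_language_iff {α : List 𝒜} : α ∈ language X ↔ ∃ x, α ++ₛ x ∈ X := by
  constructor
  · rintro ⟨x, hx, h⟩
    refine ⟨x.drop α.length, ?_⟩
    rw [← h, Stream'.length_take, h, ← h, Stream'.length_take, Stream'.append_take_drop]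
    exact hx
  · rintro ⟨x, hx⟩
    exact ⟨_, hx, take_append_length α x⟩

theorem append_eq_append_of_length_le {α β : List 𝒜} {x y : Stream' 𝒜}
    (h : α ++ₛ x = β ++ₛ y) (hl : α.length ≤ β.length) : ∃ γ, β = α ++ γ ∧ x = γ ++ₛ y := by
  have hβ := List.take_append_drop α.length β
  rw [← hβ, Stream'.append_append_stream] at h
  have h1 : α = β.take α.length :=
    Stream'.append_left_injective _ _ _ _ h (by simp [hl])
  refine ⟨β.drop α.length, ?_, ?_⟩
  · nth_rw 1 [← hβ, ← h1]
  · rw [← h1] at h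
    exact Stream'.append_right_injective _ _ _ h

/-- The equation y = γy determines y letter by letter: letter n comes from γ if n < |γ|, and equals
letter n - |γ| otherwise. Hence a nonempty word fixes at most one sequence, namely γ^∞. -/
theorem eq_of_append_eq_self {γ : List 𝒜} (hγ : γ ≠ []) {y z : Stream' 𝒜}
    (hy : γ ++ₛ y = y) (hz : γ ++ₛ z = z) : y = z := by
  ext n
  induction n using Nat.strong_induction_on with
  | _ n ih =>
    rw [← hy, ← hz]
    by_cases hn : n < γ.length
    · rw [Stream'.get_append_left _ _ _ hn, Stream'.get_append_left _ _ _ hn]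
    · obtain ⟨k, rfl⟩ := Nat.exists_eq_add_of_le (not_lt.1 hn)
      rw [Stream'.get_append_right, Stream'.get_append_right]
      exact ih k (by have := List.length_pos_iff.2 hγ; omega)

theorem mem_of_append_mem [IsShiftSpace X] {α : List 𝒜} {x : Stream' 𝒜} (h : α ++ₛ x ∈ X) : x ∈ X := by
  induction α with
  | nil => exact h
  | cons a α ih => exact ih (IsShiftSpace.tail_mem _ h)

theorem language_of_append_right [IsShiftSpace X] {α β : List 𝒜} (h : α ++ β ∈ language X) : β ∈ language X := by
  obtain ⟨x, hx⟩ := mem_language_iff.1 h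
  rw [Stream'.append_append_stream] at hx
  exact mem_language_iff.2 ⟨x, mem_of_append_mem hx⟩

/-- The set `αA ∩ X`. -/
def pushSet (α : List 𝒜) (A : Set X) : Set X := {y | ∃ x ∈ A, (y : Stream' 𝒜) = α ++ₛ x}

/-- The relative range `{y ∈ X : αy ∈ A}`. -/
def preSet (α : List 𝒜) (A : Set X) : Set X := {y | ∃ z ∈ A, (z : Stream' 𝒜) = α ++ₛ y}

end Words

/-! ### Consequences of the defining relations. -/

section Relations

variable (R : Type u) [CommRing R] {𝒜 : Type v} (X : Set (Stream' 𝒜))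

/-- The element `s_α` of the unital subshift algebra. -/
def sWord (α : List 𝒜) : UnitalSubshiftAlgebra R X :=
  RingQuot.mkAlgHom R (Rel R X) (freeSWord R X α)

/-- The element `s_α^*` of the unital subshift algebra. -/
def sStarWord (α : List 𝒜) : UnitalSubshiftAlgebra R X :=
  RingQuot.mkAlgHom R (Rel R X) (freeSStarWord R X α)

local notation "S" => sWord R X
local notation "S⋆" => sStarWord R X
local notation "P" => p R X

@[simp] theorem sWord_nil : S [] = 1 := by simp [sWord, freeSWord]

@[simp] theorem sStarWord_nil : S⋆ [] = 1 := by simp [sStarWord, freeSStarWord]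

theorem sWord_append (α β : List 𝒜) : S (α ++ β) = S α * S β := by
  simp [sWord, freeSWord]

theorem sStarWord_append (α β : List 𝒜) : S⋆ (α ++ β) = S⋆ β * S⋆ α := by
  simp [sStarWord, freeSStarWord]

theorem sWord_cons (a : 𝒜) (β : List 𝒜) : S (a :: β) = S [a] * S β := sWord_append R X [a] β

theorem sStarWord_cons (a : 𝒜) (β : List 𝒜) : S⋆ (a :: β) = S⋆ β * S⋆ [a] :=
  sStarWord_append R X [a] β

@[simp] theorem p_top : P ⊤ = 1 := by
  simpa [p] using RingQuot.mkAlgHom_rel R (Rel.p_top (R := R) (X := X))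

@[simp] theorem p_bot : P ⊥ = 0 := by
  simpa [p] using RingQuot.mkAlgHom_rel R (Rel.p_bot (R := R) (X := X))

theorem p_inf (A B : U X) : P (A ⊓ B) = P A * P B := by
  simpa [p] using RingQuot.mkAlgHom_rel R (Rel.p_inter (R := R) A B)

theorem p_sup (A B : U X) : P (A ⊔ B) = P A + P B - P (A ⊓ B) := by
  simpa [p] using RingQuot.mkAlgHom_rel R (Rel.p_union (R := R) A B)

theorem p_compl (A : U X) : P Aᶜ = 1 - P A := by
  have h := p_sup R X A Aᶜ
  simp only [sup_compl_eq_top, inf_compl_eq_bot, p_top, p_bot, sub_zero] at h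
  rw [h]; abel

theorem p_comm (A B : U X) : P A * P B = P B * P A := by
  rw [← p_inf, ← p_inf, inf_comm]

@[simp] theorem p_mul_self (A : U X) : P A * P A = P A := by
  rw [← p_inf, inf_idem]

theorem p_mul_of_le {A B : U X} (h : A ≤ B) : P A * P B = P A := by
  rw [← p_inf, inf_eq_left.2 h]

theorem sWord_word {α β : List 𝒜} (hα : α ∈ language X) (hβ : β ∈ language X) :
    S β * S⋆ α * S α * S⋆ β = P ⟨C X α β, C_mem_U X hα hβ⟩ := by
  simpa [p, sWord, sStarWord] using RingQuot.mkAlgHom_rel R (Rel.word (R := R) α β hα hβ)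

theorem s_sStar_s (a : 𝒜) : S [a] * S⋆ [a] * S [a] = S [a] := by
  simpa [sWord, sStarWord, freeSWord, freeSStarWord] using
    RingQuot.mkAlgHom_rel R (Rel.s_sStar_s (R := R) (X := X) a)

theorem sStar_s_sStar (a : 𝒜) : S⋆ [a] * S [a] * S⋆ [a] = S⋆ [a] := by
  simpa [sWord, sStarWord, freeSWord, freeSStarWord] using
    RingQuot.mkAlgHom_rel R (Rel.sStar_s_sStar (R := R) (X := X) a)

theorem nil_mem_language {α : List 𝒜} (hα : α ∈ language X) : [] ∈ language X := by
  obtain ⟨x, hx, -⟩ := hα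
  exact ⟨x, hx, rfl⟩

theorem sStarWord_mul_sWord_of_mem {α : List 𝒜} (hα : α ∈ language X) :
    S⋆ α * S α = P ⟨C X α [], C_mem_U X hα (nil_mem_language X hα)⟩ := by
  simpa using sWord_word R X hα (nil_mem_language X hα)

theorem sWord_mul_sStarWord_of_mem {α : List 𝒜} (hα : α ∈ language X) :
    S α * S⋆ α = P ⟨C X [] α, C_mem_U X (nil_mem_language X hα) hα⟩ := by
  simpa using sWord_word R X (nil_mem_language X hα) hα

/-- Relation (iii) says nothing about words outside the language, so their vanishing has to be
derived. In the inductive step s_a^* s_a and s_β s_β^* are both of the form p_A, hence commute, and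
their product is p of the intersection, which is empty when aβ is not in the language. -/
theorem sWord_eq_zero_and_partial_isometry [IsShiftSpace X] (β : List 𝒜) :
    (β ∉ language X → S β = 0 ∧ S⋆ β = 0) ∧
      S β * S⋆ β * S β = S β ∧ S⋆ β * S β * S⋆ β = S⋆ β := by
  induction β with
  | nil =>
    refine ⟨fun h => ?_, by simp, by simp⟩
    -- The empty word lies outside the language only if X is empty, and then the algebra is zero.
    have : (⊤ : U X) = ⊥ := by
      ext x
      exact absurd (mem_language_iff.2 ⟨(x : Stream' 𝒜), x.2⟩) h
    have h01 : (1 : UnitalSubshiftAlgebra R X) = 0 := by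
      rw [← p_top, this, p_bot]
    simp [h01]
  | cons a β ih =>
    obtain ⟨h0, h1, h2⟩ := ih
    have ha : [a] ∈ language X := IsShiftSpace.letter_mem a
    by_cases hβ : β ∈ language X
    · have hc : Commute (S⋆ [a] * S [a]) (S β * S⋆ β) := by
        rw [sStarWord_mul_sWord_of_mem R X ha, sWord_mul_sStarWord_of_mem R X hβ]
        exact p_comm R X _ _
      have e1 : S [a] * S β = S [a] * ((S⋆ [a] * S [a]) * (S β * S⋆ β)) * S β := by
        calc S [a] * S β = (S [a] * S⋆ [a] * S [a]) * (S β * S⋆ β * S β) := by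
              rw [h1, s_sStar_s]
          _ = _ := by noncomm_ring
      have e2 : S⋆ β * S⋆ [a] = S⋆ β * ((S⋆ [a] * S [a]) * (S β * S⋆ β)) * S⋆ [a] := by
        calc S⋆ β * S⋆ [a] = (S⋆ β * S β * S⋆ β) * (S⋆ [a] * S [a] * S⋆ [a]) := by
              rw [h2, sStar_s_sStar]
          _ = S⋆ β * ((S β * S⋆ β) * (S⋆ [a] * S [a])) * S⋆ [a] := by noncomm_ring
          _ = _ := by rw [hc.eq]
      refine ⟨fun h => ?_, ?_, ?_⟩
      · have : (S⋆ [a] * S [a]) * (S β * S⋆ β) = 0 := by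
          rw [sStarWord_mul_sWord_of_mem R X ha, sWord_mul_sStarWord_of_mem R X hβ, ← p_inf,
            ← p_bot R X]
          congr 1
          ext y
          simp only [BooleanSubalgebra.val_inf, BooleanSubalgebra.val_bot]
          constructor
          · rintro ⟨⟨x, hx, hx'⟩, ⟨z, hz, -⟩⟩
            refine h (mem_language_iff.2 ⟨z, ?_⟩)
            rw [Stream'.nil_append_stream] at hx
            rwa [← hx, hz] at hx'
          · exact fun h => h.elim
        rw [sWord_cons, sStarWord_cons, e1, e2, this]
        simp
      · rw [sWord_cons, sStarWord_cons]
        calc S [a] * S β * (S⋆ β * S⋆ [a]) * (S [a] * S β)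
            = S [a] * ((S β * S⋆ β) * (S⋆ [a] * S [a])) * S β := by noncomm_ring
          _ = _ := by rw [← hc.eq, ← e1]
      · rw [sWord_cons, sStarWord_cons]
        calc S⋆ β * S⋆ [a] * (S [a] * S β) * (S⋆ β * S⋆ [a])
            = S⋆ β * ((S⋆ [a] * S [a]) * (S β * S⋆ β)) * S⋆ [a] := by noncomm_ring
          _ = _ := by rw [← e2]
    · rw [sWord_cons, sStarWord_cons, (h0 hβ).1, (h0 hβ).2]
      simp

/-- Since v u is itself some p_E, it commutes with all p_A, so p_A ↦ u p_A v is multiplicative. The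
sets A with θ A in `U X` and u p_A v = p_{θA} therefore form a Boolean algebra, and it is enough to
test the generators C(α, β). -/
theorem conj_p_of_generators {u v : UnitalSubshiftAlgebra R X} {θ : Set X → Set X} {E G : U X}
    (hvu : v * u = P E) (huv : u * v = P G) (hv : v * u * v = v)
    (bot : θ ⊥ = ⊥) (sup : ∀ A B, θ (A ⊔ B) = θ A ⊔ θ B) (compl : ∀ A, θ Aᶜ = (G : Set X) ⊓ (θ A)ᶜ)
    (gen : ∀ α β, ∀ hα : α ∈ language X, ∀ hβ : β ∈ language X,
      ∃ B : U X, θ (C X α β) = B ∧ u * P ⟨C X α β, C_mem_U X hα hβ⟩ * v = P B) (A : U X) :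
    ∃ B : U X, θ A = B ∧ u * P A * v = P B := by
  obtain ⟨A, hA⟩ := A
  induction hA using BooleanSubalgebra.closure_bot_sup_induction with
  | mem A hA =>
    obtain ⟨α, hα, β, hβ, rfl⟩ := hA
    exact gen α β hα hβ
  | bot =>
    refine ⟨⊥, bot, ?_⟩
    have e : (⟨(⊥ : Set X), BooleanSubalgebra.bot_mem⟩ : U X) = ⊥ := rfl
    rw [e, p_bot, mul_zero, zero_mul]
  | compl A hA ih =>
    obtain ⟨B, hB, ih⟩ := ih
    refine ⟨G ⊓ Bᶜ, (compl A).trans (by rw [hB]; rfl), ?_⟩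
    have e : (⟨Aᶜ, BooleanSubalgebra.compl_mem hA⟩ : U X) = (⟨A, hA⟩ : U X)ᶜ := rfl
    have hu : u * P ⟨A, hA⟩ * v = u * v * (u * P ⟨A, hA⟩ * v) := by
      calc u * P ⟨A, hA⟩ * v = u * (P ⟨A, hA⟩ * (v * u)) * v := by
            nth_rw 1 [← hv]; simp only [mul_assoc]
        _ = u * ((v * u) * P ⟨A, hA⟩) * v := by rw [hvu, p_comm]
        _ = _ := by simp only [mul_assoc]
    rw [e, p_inf, p_compl, p_compl, ← huv, ← ih, mul_sub, sub_mul, mul_one, mul_sub, mul_one, ← hu]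
  | sup A hA B hB ihA ihB =>
    obtain ⟨A', hA', ihA⟩ := ihA
    obtain ⟨B', hB', ihB⟩ := ihB
    refine ⟨A' ⊔ B', (sup A B).trans (by rw [hA', hB']; rfl), ?_⟩
    have e : (⟨A ⊔ B, BooleanSubalgebra.supClosed _ hA hB⟩ : U X) = ⟨A, hA⟩ ⊔ ⟨B, hB⟩ := rfl
    rw [e, p_sup, p_sup, p_inf, p_inf, ← ihA, ← ihB]
    have key : u * (P ⟨A, hA⟩ * P ⟨B, hB⟩) * v = u * P ⟨A, hA⟩ * v * (u * P ⟨B, hB⟩ * v) := by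
      calc u * (P ⟨A, hA⟩ * P ⟨B, hB⟩) * v
          = u * P ⟨A, hA⟩ * (P ⟨B, hB⟩ * (v * u)) * v := by
            nth_rw 1 [← hv]; simp only [mul_assoc]
        _ = u * P ⟨A, hA⟩ * ((v * u) * P ⟨B, hB⟩) * v := by rw [hvu, p_comm]
        _ = _ := by simp only [mul_assoc]
    rw [← key, mul_sub, mul_add, sub_mul, add_mul]

variable [IsShiftSpace X]

theorem sWord_eq_zero {β : List 𝒜} (h : β ∉ language X) : S β = 0 := ((sWord_eq_zero_and_partial_isometry R X β).1 h).1

theorem sWord_mul_sStarWord_mul_sWord (β : List 𝒜) : S β * S⋆ β * S β = S β :=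
  (sWord_eq_zero_and_partial_isometry R X β).2.1

theorem sStarWord_mul_sWord_mul_sStarWord (β : List 𝒜) : S⋆ β * S β * S⋆ β = S⋆ β :=
  (sWord_eq_zero_and_partial_isometry R X β).2.2

theorem letter_sStar_mul_s (a : 𝒜) :
    S⋆ [a] * S [a] = P ⟨C X [a] [], C_mem_U X (IsShiftSpace.letter_mem a)
      (nil_mem_language X (IsShiftSpace.letter_mem a))⟩ :=
  sStarWord_mul_sWord_of_mem R X (IsShiftSpace.letter_mem a)

/-- The range projections s_a s_a^* and s_b s_b^* belong to disjoint cylinders. -/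
theorem sStar_mul_s_of_ne {a b : 𝒜} (h : a ≠ b) : S⋆ [a] * S [b] = 0 := by
  have ha := sWord_mul_sStarWord_of_mem R X (IsShiftSpace.letter_mem a : [a] ∈ language X)
  have hb := sWord_mul_sStarWord_of_mem R X (IsShiftSpace.letter_mem b : [b] ∈ language X)
  have key : (S [a] * S⋆ [a]) * (S [b] * S⋆ [b]) = 0 := by
    rw [ha, hb, ← p_inf, ← p_bot R X]
    congr 1
    ext y
    simp only [BooleanSubalgebra.val_inf, BooleanSubalgebra.val_bot]
    constructor
    · rintro ⟨⟨x, hx, -⟩, ⟨z, hz, -⟩⟩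
      rw [hx] at hz
      exact h (congrArg Stream'.head hz)
    · exact fun h => h.elim
  calc S⋆ [a] * S [b] = (S⋆ [a] * S [a] * S⋆ [a]) * (S [b] * S⋆ [b] * S [b]) := by
        rw [s_sStar_s, sStar_s_sStar]
    _ = S⋆ [a] * ((S [a] * S⋆ [a]) * (S [b] * S⋆ [b])) * S [b] := by noncomm_ring
    _ = 0 := by rw [key]; simp

theorem push_letter (a : 𝒜) (A : U X) :
    ∃ B : U X, pushSet [a] (A : Set X) = B ∧ S [a] * P A * S⋆ [a] = P B := by
  have haL : [a] ∈ language X := IsShiftSpace.letter_mem a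
  refine conj_p_of_generators R X (letter_sStar_mul_s R X a) (sWord_mul_sStarWord_of_mem R X haL)
    (sStar_s_sStar R X a) ?_ ?_ ?_ ?_ A
  · ext y
    exact ⟨fun ⟨z, hz, _⟩ => hz.elim, fun h => h.elim⟩
  · intro A B
    ext y
    constructor
    · rintro ⟨x, hx | hx, hy⟩
      exacts [Or.inl ⟨x, hx, hy⟩, Or.inr ⟨x, hx, hy⟩]
    · rintro (⟨x, hx, hy⟩ | ⟨x, hx, hy⟩)
      exacts [⟨x, Or.inl hx, hy⟩, ⟨x, Or.inr hx, hy⟩]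
  · intro A
    ext y
    constructor
    · rintro ⟨x, hx, hy⟩
      refine ⟨⟨x, hy, x.2⟩, fun ⟨x', hx', hy'⟩ => hx ?_⟩
      rw [hy] at hy'
      rwa [← Subtype.ext (Stream'.append_right_injective _ _ _ hy')] at hx'
    · rintro ⟨⟨x, hx, hx'⟩, hy⟩
      exact ⟨⟨x, hx'⟩, fun h => hy ⟨_, h, hx⟩, hx⟩
  · intro α β hα hβ
    have hs : pushSet [a] (C X α β) = C X α (a :: β) := by
      ext y
      constructor
      · rintro ⟨x, ⟨z, hz, hz'⟩, hy⟩
        exact ⟨z, by rw [hy, hz]; rfl, hz'⟩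
      · rintro ⟨z, hz, hz'⟩
        have : [a] ++ₛ (β ++ₛ z) ∈ X := by have := y.2; rw [hz] at this; exact this
        exact ⟨⟨β ++ₛ z, mem_of_append_mem this⟩, ⟨z, rfl, hz'⟩, hz⟩
    have e : S [a] * (S β * S⋆ α * S α * S⋆ β) * S⋆ [a]
        = S (a :: β) * S⋆ α * S α * S⋆ (a :: β) := by
      rw [sWord_cons R X a β, sStarWord_cons R X a β]; simp only [mul_assoc]
    rw [← sWord_word R X hα hβ, e]
    by_cases hab : a :: β ∈ language X
    · exact ⟨_, hs, sWord_word R X hα hab⟩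
    · refine ⟨⊥, ?_, ?_⟩
      · rw [hs]
        ext y
        exact ⟨fun ⟨z, hz, _⟩ => hab (mem_language_iff.2 ⟨z, hz ▸ y.2⟩), fun h => h.elim⟩
      · rw [sWord_eq_zero R X hab, p_bot]
        simp only [zero_mul]

theorem pre_letter (a : 𝒜) (A : U X) :
    ∃ B : U X, preSet [a] (A : Set X) = B ∧ S⋆ [a] * P A * S [a] = P B := by
  have haL : [a] ∈ language X := IsShiftSpace.letter_mem a
  have hn : [] ∈ language X := nil_mem_language X haL
  have htop := letter_sStar_mul_s R X a
  refine conj_p_of_generators R X (sWord_mul_sStarWord_of_mem R X haL) htop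
    (s_sStar_s R X a) ?_ ?_ ?_ ?_ A
  · ext y
    exact ⟨fun ⟨z, hz, _⟩ => hz.elim, fun h => h.elim⟩
  · intro A B
    ext y
    constructor
    · rintro ⟨x, hx | hx, hy⟩
      exacts [Or.inl ⟨x, hx, hy⟩, Or.inr ⟨x, hx, hy⟩]
    · rintro (⟨x, hx, hy⟩ | ⟨x, hx, hy⟩)
      exacts [⟨x, Or.inl hx, hy⟩, ⟨x, Or.inr hx, hy⟩]
  · intro A
    ext y
    constructor
    · rintro ⟨z, hz, hy⟩
      refine ⟨⟨y, rfl, hy ▸ z.2⟩, fun ⟨z', hz', hy'⟩ => hz ?_⟩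
      rwa [Subtype.ext (hy.trans hy'.symm)]
    · rintro ⟨⟨w, hw, hw'⟩, hy⟩
      rw [Stream'.nil_append_stream] at hw
      subst hw
      exact ⟨⟨_, hw'⟩, fun h => hy ⟨_, h, rfl⟩, rfl⟩
  · intro α β hα hβ
    rw [← sWord_word R X hα hβ]
    cases β with
    | nil =>
      have e : S⋆ [a] * (S [] * S⋆ α * S α * S⋆ []) * S [a] = S⋆ (α ++ [a]) * S (α ++ [a]) := by
        rw [sWord_append, sStarWord_append]; simp only [sWord_nil, sStarWord_nil, one_mul, mul_one,
          mul_assoc]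
      rw [e]
      by_cases h : α ++ [a] ∈ language X
      · refine ⟨_, ?_, sStarWord_mul_sWord_of_mem R X h⟩
        ext y
        constructor
        · rintro ⟨z, ⟨x, hx, hx'⟩, hz⟩
          refine ⟨y, rfl, ?_⟩
          rw [hz] at hx
          rw [Stream'.append_append_stream, hx]; exact hx'
        · rintro ⟨x, hx, hx'⟩
          rw [Stream'.append_append_stream] at hx'
          rw [Stream'.nil_append_stream] at hx
          subst hx
          exact ⟨⟨_, mem_of_append_mem hx'⟩, ⟨_, rfl, hx'⟩, rfl⟩
      · refine ⟨⊥, ?_, by rw [sWord_eq_zero R X h, p_bot, mul_zero]⟩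
        ext y
        refine ⟨?_, fun h => h.elim⟩
        rintro ⟨z, ⟨x, hx, hx'⟩, hz⟩
        refine h (mem_language_iff.2 ⟨y, ?_⟩)
        rw [hz] at hx
        rw [Stream'.append_append_stream, hx]; exact hx'
    | cons b β =>
      by_cases hab : a = b
      · subst hab
        have hβ' : β ∈ language X := language_of_append_right (α := [a]) hβ
        have hU := C_mem_U X haL hn
        -- The repeated factor C(a, ω) mirrors the two factors s_a^* s_a that surround p_{C(α,β)} in
        -- the product.
        refine ⟨⟨_, hU⟩ ⊓ ⟨_, C_mem_U X hα hβ'⟩ ⊓ ⟨_, hU⟩, ?_, ?_⟩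
        · ext y
          constructor
          · rintro ⟨z, ⟨x, hx, hx'⟩, hz⟩
            have hy : (y : Stream' 𝒜) = β ++ₛ x := by
              rw [hz] at hx; exact Stream'.append_right_injective [a] _ _ hx
            have h1 : y ∈ C X [a] [] := ⟨y, rfl, by rw [← hz]; exact z.2⟩
            exact ⟨⟨h1, ⟨x, hy, hx'⟩⟩, h1⟩
          · rintro ⟨⟨⟨w, hw, hw'⟩, ⟨x, hx, hx'⟩⟩, -⟩
            rw [Stream'.nil_append_stream] at hw
            subst hw
            refine ⟨⟨_, hw'⟩, ⟨x, ?_, hx'⟩, rfl⟩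
            show [a] ++ₛ (y : Stream' 𝒜) = _
            rw [hx]; rfl
        · rw [p_inf, p_inf, ← htop, ← sWord_word R X hα hβ', sWord_cons R X a β,
            sStarWord_cons R X a β]
          simp only [mul_assoc]
      · refine ⟨⊥, ?_, ?_⟩
        · ext y
          refine ⟨?_, fun h => h.elim⟩
          rintro ⟨z, ⟨x, hx, hx'⟩, hz⟩
          rw [hz] at hx
          exact hab (congrArg Stream'.head hx)
        · rw [p_bot, sWord_cons]
          simp only [← mul_assoc]
          rw [sStar_mul_s_of_ne R X hab]
          simp only [zero_mul]

end Relations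

/-! ### The algebra of sets is stable under prefixing and deleting words. -/

section Sets

variable {𝒜 : Type v} {X : Set (Stream' 𝒜)} [IsShiftSpace X]

omit [IsShiftSpace X] in
theorem pushSet_nil (A : Set X) : pushSet [] A = A := by
  ext y
  refine ⟨fun ⟨x, hx, hy⟩ => ?_, fun hy => ⟨y, hy, rfl⟩⟩
  rwa [Subtype.ext hy]

omit [IsShiftSpace X] in
theorem preSet_nil (A : Set X) : preSet [] A = A := by
  ext y
  refine ⟨fun ⟨x, hx, hy⟩ => ?_, fun hy => ⟨y, hy, rfl⟩⟩
  rwa [← (Subtype.ext hy : x = y)]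

theorem pushSet_cons (a : 𝒜) (α : List 𝒜) (A : Set X) :
    pushSet (a :: α) A = pushSet [a] (pushSet α A) := by
  ext y
  constructor
  · rintro ⟨x, hx, hy⟩
    have : [a] ++ₛ (α ++ₛ x) ∈ X := by have h := y.2; rw [hy] at h; exact h
    exact ⟨⟨_, mem_of_append_mem this⟩, ⟨x, hx, rfl⟩, hy⟩
  · rintro ⟨z, ⟨x, hx, hz⟩, hy⟩
    exact ⟨x, hx, by rw [hy, hz]; rfl⟩

theorem preSet_cons (a : 𝒜) (α : List 𝒜) (A : Set X) :
    preSet (a :: α) A = preSet α (preSet [a] A) := by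
  ext y
  constructor
  · rintro ⟨x, hx, hy⟩
    have : [a] ++ₛ (α ++ₛ y) ∈ X := by have h := x.2; rw [hy] at h; exact h
    exact ⟨⟨_, mem_of_append_mem this⟩, ⟨x, hx, hy⟩, rfl⟩
  · rintro ⟨z, ⟨x, hx, hz⟩, hy⟩
    exact ⟨x, hx, by rw [hz, hy]; rfl⟩

theorem pushSet_mem (α : List 𝒜) (A : U X) : pushSet α (A : Set X) ∈ U X := by
  induction α with
  | nil => rw [pushSet_nil]; exact A.2
  | cons a α ih =>
    -- Membership in `U X` does not involve the coefficients, so any ring serves here.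
    obtain ⟨B, hB, -⟩ := push_letter ℤ X a ⟨_, ih⟩
    rw [pushSet_cons]
    exact hB ▸ B.2

theorem preSet_mem (α : List 𝒜) (A : U X) : preSet α (A : Set X) ∈ U X := by
  induction α generalizing A with
  | nil => rw [preSet_nil]; exact A.2
  | cons a α ih =>
    obtain ⟨B, hB, -⟩ := pre_letter ℤ X a A
    rw [preSet_cons, hB]
    exact ih B

/-- The element `αA ∩ X` of the Boolean algebra `U X`. -/
def push (α : List 𝒜) (A : U X) : U X := ⟨pushSet α A, pushSet_mem α A⟩

/-- The element `{y ∈ X : αy ∈ A}` of the Boolean algebra `U X`. -/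
def pre (α : List 𝒜) (A : U X) : U X := ⟨preSet α A, preSet_mem α A⟩

theorem mem_pre {α : List 𝒜} {A : U X} {y : X} :
    y ∈ (pre α A : Set X) ↔ ∃ z ∈ (A : Set X), (z : Stream' 𝒜) = α ++ₛ y := Iff.rfl

theorem mem_push_top {α : List 𝒜} {y : X} :
    y ∈ (push α (⊤ : U X) : Set X) ↔ ∃ x, (y : Stream' 𝒜) = α ++ₛ x := by
  constructor
  · rintro ⟨x, -, hx⟩
    exact ⟨x, hx⟩
  · rintro ⟨x, hx⟩
    have h := y.2
    rw [hx] at h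
    exact ⟨⟨x, mem_of_append_mem h⟩, trivial, hx⟩

theorem push_nil (A : U X) : push [] A = A := Subtype.ext (pushSet_nil _)

theorem pre_nil (A : U X) : pre [] A = A := Subtype.ext (preSet_nil _)

theorem push_cons (a : 𝒜) (α : List 𝒜) (A : U X) : push (a :: α) A = push [a] (push α A) :=
  Subtype.ext (pushSet_cons a α _)

theorem pre_cons (a : 𝒜) (α : List 𝒜) (A : U X) : pre (a :: α) A = pre α (pre [a] A) :=
  Subtype.ext (preSet_cons a α _)

end Sets

/-! ### Multiplication rules and spanning monomials s_α p_A s_β^*. -/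

section Products

variable (R : Type u) [CommRing R] {𝒜 : Type v} (X : Set (Stream' 𝒜)) [IsShiftSpace X]

local notation "S" => sWord R X
local notation "S⋆" => sStarWord R X
local notation "P" => p R X

theorem sWord_mul_p_mul_sStarWord (α : List 𝒜) (A : U X) :
    S α * P A * S⋆ α = P (push α A) := by
  induction α with
  | nil => simp [push_nil]
  | cons a α ih =>
    obtain ⟨B, hB, h⟩ := push_letter R X a (push α A)
    rw [push_cons, show push [a] (push α A) = B from Subtype.ext hB, ← h, ← ih,
      sWord_cons, sStarWord_cons]
    simp only [mul_assoc]

theorem sStarWord_mul_p_mul_sWord (α : List 𝒜) (A : U X) :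
    S⋆ α * P A * S α = P (pre α A) := by
  induction α generalizing A with
  | nil => simp [pre_nil]
  | cons a α ih =>
    obtain ⟨B, hB, h⟩ := pre_letter R X a A
    rw [pre_cons, ← ih, show pre [a] A = B from Subtype.ext hB, ← h, sWord_cons, sStarWord_cons]
    simp only [mul_assoc]

theorem sWord_mul_sStarWord (α : List 𝒜) : S α * S⋆ α = P (push α ⊤) := by
  rw [← sWord_mul_p_mul_sStarWord, p_top, mul_one]

theorem sStarWord_mul_sWord (α : List 𝒜) : S⋆ α * S α = P (pre α ⊤) := by
  rw [← sStarWord_mul_p_mul_sWord, p_top, mul_one]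

theorem p_mul_sWord (α : List 𝒜) (A : U X) : P A * S α = S α * P (pre α A) := by
  rw [← sStarWord_mul_p_mul_sWord, ← mul_assoc, ← mul_assoc, sWord_mul_sStarWord, p_comm, mul_assoc,
    ← sWord_mul_sStarWord, sWord_mul_sStarWord_mul_sWord]

theorem sStarWord_mul_p (α : List 𝒜) (A : U X) : S⋆ α * P A = P (pre α A) * S⋆ α := by
  rw [← sStarWord_mul_p_mul_sWord, mul_assoc, sWord_mul_sStarWord, mul_assoc, p_comm,
    ← sWord_mul_sStarWord, ← mul_assoc, ← mul_assoc, sStarWord_mul_sWord_mul_sStarWord]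

/-- Common initial letters are cancelled, leaving a projection that moves out to the left; the first
letter where the words differ gives s_a^* s_b = 0. -/
theorem sStarWord_mul_sWord_eq_zero {α β : List 𝒜} (hl : α.length ≤ β.length)
    (h : ∀ γ, β ≠ α ++ γ) : S⋆ α * S β = 0 := by
  induction α generalizing β with
  | nil => exact absurd rfl (h β)
  | cons a α ih =>
    cases β with
    | nil => simp at hl
    | cons b β =>
      rw [sStarWord_cons R X a α, sWord_cons R X b β]
      by_cases hab : a = b
      · subst hab
        calc S⋆ α * S⋆ [a] * (S [a] * S β) = S⋆ α * (S⋆ [a] * S [a]) * S β := by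
              simp only [mul_assoc]
          _ = P (pre α (pre [a] ⊤)) * (S⋆ α * S β) := by
              rw [sStarWord_mul_sWord, sStarWord_mul_p, mul_assoc]
          _ = 0 := by
              rw [ih (by simpa using hl) (fun γ hγ => h γ (by rw [hγ]; rfl)), mul_zero]
      · calc S⋆ α * S⋆ [a] * (S [b] * S β) = S⋆ α * (S⋆ [a] * S [b]) * S β := by
              simp only [mul_assoc]
          _ = 0 := by rw [sStar_mul_s_of_ne R X hab]; simp

theorem sStarWord_mul_sWord_append (α γ : List 𝒜) :
    S⋆ α * S (α ++ γ) = S γ * P (pre γ (pre α ⊤)) := by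
  rw [sWord_append, ← mul_assoc, sStarWord_mul_sWord, p_mul_sWord]

/-- The span contains 1 and is stable under left multiplication by every generator. -/
theorem span_monomial_eq_top :
    Submodule.span R (Set.range fun t : List 𝒜 × U X × List 𝒜 => S t.1 * P t.2.1 * S⋆ t.2.2)
      = ⊤ := by
  set M := Submodule.span R
    (Set.range fun t : List 𝒜 × U X × List 𝒜 => S t.1 * P t.2.1 * S⋆ t.2.2) with hM
  have mon (α : List 𝒜) (A : U X) (β : List 𝒜) : S α * P A * S⋆ β ∈ M :=
    Submodule.subset_span ⟨(α, A, β), rfl⟩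
  have key (z : UnitalSubshiftAlgebra R X) (hz : ∀ α A β, z * (S α * P A * S⋆ β) ∈ M) :
      ∀ m ∈ M, z * m ∈ M := by
    intro m hm
    induction hm using Submodule.span_induction with
    | mem m h => obtain ⟨⟨α, A, β⟩, rfl⟩ := h; exact hz α A β
    | zero => simp
    | add a b _ _ ha hb => rw [mul_add]; exact M.add_mem ha hb
    | smul c a _ ha => rw [mul_smul_comm]; exact M.smul_mem c ha
  have all (f : FreeAlgebra R (Generator X)) : ∀ m ∈ M, RingQuot.mkAlgHom R (Rel R X) f * m ∈ M := by
    induction f using FreeAlgebra.induction with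
    | grade0 r =>
      intro m hm
      rw [AlgHom.commutes, ← Algebra.smul_def]
      exact M.smul_mem r hm
    | grade1 g =>
      cases g with
      | p B =>
        refine key _ fun α A β => ?_
        change P B * _ ∈ M
        rw [← mul_assoc, ← mul_assoc, p_mul_sWord, mul_assoc (S α), ← p_inf]
        exact mon _ _ _
      | s a =>
        refine key _ fun α A β => ?_
        have : RingQuot.mkAlgHom R (Rel R X) (FreeAlgebra.ι R (Generator.s a)) = S [a] := by
          simp [sWord, freeSWord, freeS]
        rw [this, ← mul_assoc, ← mul_assoc, ← sWord_append]
        exact mon _ _ _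
      | sStar a =>
        refine key _ fun α A β => ?_
        have : RingQuot.mkAlgHom R (Rel R X) (FreeAlgebra.ι R (Generator.sStar a)) = S⋆ [a] := by
          simp [sStarWord, freeSStarWord, freeSStar]
        rw [this]
        cases α with
        | nil =>
          rw [sWord_nil, one_mul, ← mul_assoc, sStarWord_mul_p, mul_assoc, ← sStarWord_append]
          simpa using mon [] (pre [a] A) (β ++ [a])
        | cons b α =>
          by_cases hab : a = b
          · subst hab
            have e : S⋆ [a] * S (a :: α) = _ := sStarWord_mul_sWord_append R X [a] α
            rw [← mul_assoc, ← mul_assoc, e, mul_assoc (S α),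
              ← p_inf]
            exact mon _ _ _
          · rw [sWord_cons R X b α, ← mul_assoc, ← mul_assoc, ← mul_assoc,
              sStar_mul_s_of_ne R X hab]
            simp
    | mul a b ha hb =>
      intro m hm
      rw [map_mul, mul_assoc]
      exact ha _ (hb _ hm)
    | add a b ha hb =>
      intro m hm
      rw [map_add, add_mul]
      exact M.add_mem (ha _ hm) (hb _ hm)
  rw [eq_top_iff]
  rintro x -
  obtain ⟨f, rfl⟩ := RingQuot.mkAlgHom_surjective R (Rel R X) x
  have h1 : (1 : UnitalSubshiftAlgebra R X) ∈ M := by simpa using mon [] ⊤ []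
  simpa using all f 1 h1

end Products

/-! ### A representation over Laurent polynomials and its diagonal coefficients. -/

section Representation

open LaurentPolynomial

variable (R : Type u) [CommRing R] {𝒜 : Type v} (X : Set (Stream' 𝒜))

/-- The operator `f ↦ 1_A f` on functions on `X`. -/
noncomputable def opP (A : Set X) : Module.End R[T;T⁻¹] (X → R[T;T⁻¹]) where
  toFun f y := A.indicator f y
  map_add' f g := by
    funext y; by_cases h : y ∈ A <;> simp [h]
  map_smul' c f := by
    funext y; by_cases h : y ∈ A <;> simp [h]

/-- A function on `X`, extended by zero to all sequences. -/
noncomputable def extendZero (f : X → R[T;T⁻¹]) (z : Stream' 𝒜) : R[T;T⁻¹] :=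
  open Classical in if h : z ∈ X then f ⟨z, h⟩ else 0

/-- The operator sending `f` to the function that is `T ^ |β| f(x)` at `βx`, and zero
outside of `βX`. -/
noncomputable def opS (β : List 𝒜) : Module.End R[T;T⁻¹] (X → R[T;T⁻¹]) where
  toFun f y := open Classical in
    if ∃ x : Stream' 𝒜, (y : Stream' 𝒜) = β ++ₛ x then
      T β.length * extendZero R X f ((y : Stream' 𝒜).drop β.length) else 0
  map_add' f g := by
    funext y
    simp only [extendZero, Pi.add_apply]
    split_ifs <;> simp [mul_add]
  map_smul' c f := by
    funext y
    simp only [extendZero, Pi.smul_apply, smul_eq_mul, RingHom.id_apply]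
    split_ifs <;> simp [mul_left_comm]

/-- The operator sending `f` to the function `x ↦ T ^ (-|β|) f(βx)`. -/
noncomputable def opSStar (β : List 𝒜) : Module.End R[T;T⁻¹] (X → R[T;T⁻¹]) where
  toFun f x := T (-β.length) * extendZero R X f (β ++ₛ (x : Stream' 𝒜))
  map_add' f g := by
    funext y
    simp only [extendZero, Pi.add_apply]
    split_ifs <;> simp [mul_add]
  map_smul' c f := by
    funext y
    simp only [extendZero, Pi.smul_apply, smul_eq_mul, RingHom.id_apply]
    split_ifs <;> simp [mul_left_comm]

theorem opP_apply_of_mem {A : Set X} {y : X} (h : y ∈ A) (f) : opP R X A f y = f y :=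
  Set.indicator_of_mem h f

theorem opP_apply_of_notMem {A : Set X} {y : X} (h : y ∉ A) (f) : opP R X A f y = 0 :=
  Set.indicator_of_notMem h f

theorem extendZero_of_mem {z : Stream' 𝒜} (h : z ∈ X) (f) : extendZero R X f z = f ⟨z, h⟩ :=
  dif_pos h

theorem extendZero_of_notMem {z : Stream' 𝒜} (h : z ∉ X) (f) : extendZero R X f z = 0 :=
  dif_neg h

theorem opS_apply_append {β : List 𝒜} {y x : X} (h : (y : Stream' 𝒜) = β ++ₛ (x : Stream' 𝒜))
    (f) : opS R X β f y = T β.length * f x := by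
  have hd : (y : Stream' 𝒜).drop β.length = x := by rw [h, Stream'.drop_append_stream]
  simp only [opS, LinearMap.coe_mk, AddHom.coe_mk]
  rw [if_pos ⟨_, h⟩, hd, extendZero_of_mem R X x.2]

theorem opS_apply_of_not {β : List 𝒜} {y : X} (h : ∀ x, (y : Stream' 𝒜) ≠ β ++ₛ x) (f) :
    opS R X β f y = 0 :=
  if_neg fun ⟨x, hx⟩ => h x hx

theorem opSStar_apply_append {β : List 𝒜} {y x : X}
    (h : (y : Stream' 𝒜) = β ++ₛ (x : Stream' 𝒜)) (f) :
    opSStar R X β f x = T (-β.length) * f y := by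
  simp only [opSStar, LinearMap.coe_mk, AddHom.coe_mk]
  rw [← h, extendZero_of_mem R X y.2]

theorem opSStar_apply_of_notMem {β : List 𝒜} {x : X} (h : β ++ₛ (x : Stream' 𝒜) ∉ X) (f) :
    opSStar R X β f x = 0 := by
  simp only [opSStar, LinearMap.coe_mk, AddHom.coe_mk]
  rw [extendZero_of_notMem R X h, mul_zero]

variable [IsShiftSpace X]

omit [IsShiftSpace X] in
theorem opS_nil : opS R X [] = 1 := by
  ext f y : 2
  rw [opS_apply_append R X (x := y) rfl]; simp

omit [IsShiftSpace X] in
theorem opSStar_nil : opSStar R X [] = 1 := by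
  ext f y : 2
  rw [opSStar_apply_append R X (y := y) rfl]; simp

theorem opS_append (α β : List 𝒜) : opS R X (α ++ β) = opS R X α * opS R X β := by
  refine LinearMap.ext fun f => funext fun y => ?_
  rw [Module.End.mul_apply]
  by_cases h : ∃ x, (y : Stream' 𝒜) = α ++ₛ x
  · obtain ⟨x, hx⟩ := h
    have hxX : x ∈ X := mem_of_append_mem (hx ▸ y.2)
    lift x to X using hxX
    rw [opS_apply_append R X hx]
    by_cases h : ∃ z, (x : Stream' 𝒜) = β ++ₛ z
    · obtain ⟨z, hz⟩ := h
      have hzX : z ∈ X := mem_of_append_mem (hz ▸ x.2)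
      lift z to X using hzX
      rw [opS_apply_append R X hz, opS_apply_append R X (x := z) (by simp [hx, hz]),
        ← mul_assoc, ← T_add]
      simp
    · push Not at h
      rw [opS_apply_of_not R X h, opS_apply_of_not, mul_zero]
      intro z hz
      rw [hx, Stream'.append_append_stream] at hz
      exact h z (Stream'.append_right_injective _ _ _ hz)
  · push Not at h
    rw [opS_apply_of_not R X h, opS_apply_of_not]
    intro z hz
    exact h (β ++ₛ z) (by rw [hz, Stream'.append_append_stream])

theorem opSStar_append (α β : List 𝒜) :
    opSStar R X (α ++ β) = opSStar R X β * opSStar R X α := by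
  refine LinearMap.ext fun f => funext fun x => ?_
  rw [Module.End.mul_apply]
  by_cases h : (α ++ β) ++ₛ (x : Stream' 𝒜) ∈ X
  · have h' := h
    rw [Stream'.append_append_stream] at h'
    have hβ : β ++ₛ (x : Stream' 𝒜) ∈ X := mem_of_append_mem h'
    rw [opSStar_apply_append R X (y := ⟨_, h⟩) rfl, opSStar_apply_append R X (y := ⟨_, hβ⟩) rfl,
      opSStar_apply_append R X (y := ⟨_, h⟩) (by simp), ← mul_assoc, ← T_add]
    congr 2
    simp
  · rw [opSStar_apply_of_notMem R X h]
    by_cases hβ : β ++ₛ (x : Stream' 𝒜) ∈ X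
    · rw [opSStar_apply_append R X (y := ⟨_, hβ⟩) rfl, opSStar_apply_of_notMem, mul_zero]
      rwa [Stream'.append_append_stream] at h
    · rw [opSStar_apply_of_notMem R X hβ]

theorem opS_mul_opSStar_mul_opS_mul_opSStar (α β : List 𝒜) :
    opS R X β * opSStar R X α * opS R X α * opSStar R X β = opP R X (C X α β) := by
  refine LinearMap.ext fun f => funext fun y => ?_
  simp only [Module.End.mul_apply]
  by_cases h : ∃ x, (y : Stream' 𝒜) = β ++ₛ x
  · obtain ⟨x, hx⟩ := h
    have hxX : x ∈ X := mem_of_append_mem (hx ▸ y.2)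
    lift x to X using hxX
    rw [opS_apply_append R X hx]
    by_cases h : α ++ₛ (x : Stream' 𝒜) ∈ X
    · rw [opSStar_apply_append R X (y := ⟨_, h⟩) rfl, opS_apply_append R X (x := x) rfl,
        opSStar_apply_append R X hx, opP_apply_of_mem R X (show y ∈ C X α β from ⟨x, hx, h⟩)]
      simp only [← mul_assoc, ← T_add]
      simp
    · rw [opSStar_apply_of_notMem R X h, mul_zero, opP_apply_of_notMem]
      rintro ⟨x', hx', h'⟩
      rw [hx] at hx'
      rw [← Stream'.append_right_injective _ _ _ hx'] at h'
      exact h h'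
  · push Not at h
    rw [opS_apply_of_not R X h, opP_apply_of_notMem]
    rintro ⟨x, hx, -⟩
    exact h x hx

theorem opS_mul_opSStar_mul_opS (α : List 𝒜) :
    opS R X α * opSStar R X α * opS R X α = opS R X α := by
  refine LinearMap.ext fun f => funext fun y => ?_
  simp only [Module.End.mul_apply]
  by_cases h : ∃ x, (y : Stream' 𝒜) = α ++ₛ x
  · obtain ⟨x, hx⟩ := h
    have hxX : x ∈ X := mem_of_append_mem (hx ▸ y.2)
    lift x to X using hxX
    rw [opS_apply_append R X hx, opS_apply_append R X hx, opSStar_apply_append R X hx,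
      opS_apply_append R X hx]
    simp only [← mul_assoc, ← T_add]
    simp
  · push Not at h
    rw [opS_apply_of_not R X h, opS_apply_of_not R X h]

omit [IsShiftSpace X] in
theorem opSStar_mul_opS_mul_opSStar (α : List 𝒜) :
    opSStar R X α * opS R X α * opSStar R X α = opSStar R X α := by
  refine LinearMap.ext fun f => funext fun x => ?_
  simp only [Module.End.mul_apply]
  by_cases h : α ++ₛ (x : Stream' 𝒜) ∈ X
  · rw [opSStar_apply_append R X (y := ⟨_, h⟩) rfl, opS_apply_append R X (x := x) rfl,
      opSStar_apply_append R X (y := ⟨_, h⟩) rfl]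
    simp only [← mul_assoc, ← T_add]
    simp
  · rw [opSStar_apply_of_notMem R X h, opSStar_apply_of_notMem R X h]

/-- The images of the generators in the regular representation. -/
noncomputable def opGenerator : Generator X → Module.End R[T;T⁻¹] (X → R[T;T⁻¹])
  | .p A => opP R X A
  | .s a => opS R X [a]
  | .sStar a => opSStar R X [a]

omit [IsShiftSpace X] in
theorem lift_freeP (A : U X) : FreeAlgebra.lift R (opGenerator R X) (freeP R X A) = opP R X A := by
  simp [freeP, opGenerator]

theorem lift_freeSWord (α : List 𝒜) :
    FreeAlgebra.lift R (opGenerator R X) (freeSWord R X α) = opS R X α := by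
  induction α with
  | nil => simp [freeSWord, opS_nil]
  | cons a α ih =>
    have : freeSWord R X (a :: α) = freeS R X a * freeSWord R X α := by simp [freeSWord]
    rw [this, map_mul, ih, ← List.singleton_append, opS_append]
    simp [freeS, opGenerator]

theorem lift_freeSStarWord (α : List 𝒜) :
    FreeAlgebra.lift R (opGenerator R X) (freeSStarWord R X α) = opSStar R X α := by
  induction α with
  | nil => simp [freeSStarWord, opSStar_nil]
  | cons a α ih =>
    have : freeSStarWord R X (a :: α) = freeSStarWord R X α * freeSStar R X a := by
      simp [freeSStarWord]
    rw [this, map_mul, ih, ← List.singleton_append, opSStar_append]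
    simp [freeSStar, opGenerator]

theorem lift_rel {x y : FreeAlgebra R (Generator X)} (h : Rel R X x y) :
    FreeAlgebra.lift R (opGenerator R X) x = FreeAlgebra.lift R (opGenerator R X) y := by
  have hs (a : 𝒜) : FreeAlgebra.lift R (opGenerator R X) (freeS R X a) = opS R X [a] := by
    simp [freeS, opGenerator]
  have hs' (a : 𝒜) : FreeAlgebra.lift R (opGenerator R X) (freeSStar R X a) = opSStar R X [a] := by
    simp [freeSStar, opGenerator]
  cases h with
  | p_top =>
    rw [lift_freeP, map_one]
    refine LinearMap.ext fun f => funext fun y => ?_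
    exact opP_apply_of_mem R X (Set.mem_univ y) f
  | p_inter A B =>
    rw [map_mul, lift_freeP, lift_freeP, lift_freeP]
    refine LinearMap.ext fun f => ?_
    exact (Set.indicator_indicator (A : Set X) B f).symm
  | p_union A B =>
    rw [map_sub, map_add, lift_freeP, lift_freeP, lift_freeP, lift_freeP, eq_sub_iff_add_eq]
    refine LinearMap.ext fun f => ?_
    exact Set.indicator_union_add_inter f (A : Set X) B
  | p_bot =>
    rw [lift_freeP, map_zero]
    refine LinearMap.ext fun f => funext fun y => ?_
    exact opP_apply_of_notMem R X (Set.notMem_empty y) f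
  | s_sStar_s a =>
    rw [map_mul, map_mul, hs, hs', opS_mul_opSStar_mul_opS]
  | sStar_s_sStar a =>
    rw [map_mul, map_mul, hs, hs', opSStar_mul_opS_mul_opSStar]
  | word α β hα hβ =>
    rw [lift_freeP, map_mul, map_mul, map_mul, lift_freeSWord, lift_freeSWord, lift_freeSStarWord,
      lift_freeSStarWord, opS_mul_opSStar_mul_opS_mul_opSStar]

/-- The graded regular representation of the unital subshift algebra on functions on `X`. -/
noncomputable def rep : UnitalSubshiftAlgebra R X →ₐ[R] Module.End R[T;T⁻¹] (X → R[T;T⁻¹]) :=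
  RingQuot.liftAlgHom R ⟨FreeAlgebra.lift R (opGenerator R X), fun _ _ h => lift_rel R X h⟩

theorem rep_p (A : U X) : rep R X (p R X A) = opP R X A := by
  rw [rep, p, RingQuot.liftAlgHom_mkAlgHom_apply, lift_freeP]

theorem rep_sWord (α : List 𝒜) : rep R X (sWord R X α) = opS R X α := by
  rw [rep, sWord, RingQuot.liftAlgHom_mkAlgHom_apply, lift_freeSWord]

open Classical in
/-- The diagonal matrix coefficient at `y` of the graded regular representation. -/
noncomputable def coeffAt (y : X) : UnitalSubshiftAlgebra R X →ₗ[R] R[T;T⁻¹] where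
  toFun a := rep R X a (Pi.single y 1) y
  map_add' a b := by simp
  map_smul' c a := by simp

variable {X}

open Classical in
theorem coeffAt_apply (y : X) (a : UnitalSubshiftAlgebra R X) :
    coeffAt R X y a = rep R X a (Pi.single y 1) y := rfl

theorem coeffAt_p_of_mem {y : X} {A : U X} (h : y ∈ (A : Set X)) :
    coeffAt R X y (p R X A) = 1 := by
  classical
  rw [coeffAt_apply, rep_p, opP_apply_of_mem R X h, Pi.single_eq_same]

/-- The relations do not collapse p_A, because the representation sends it to multiplication by the
indicator of A. -/
theorem p_ne_zero [Nontrivial R] {y : X} {A : U X} (h : y ∈ (A : Set X)) : p R X A ≠ 0 := by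
  intro h0
  have := coeffAt_p_of_mem R h
  rw [h0, map_zero] at this
  exact zero_ne_one this

theorem coeffAt_sWord_mul_p_of_mem {y : X} {γ : List 𝒜} (hγ : γ ++ₛ (y : Stream' 𝒜) = y)
    {A : U X} (h : y ∈ (A : Set X)) :
    coeffAt R X y (sWord R X γ * p R X A) = T γ.length := by
  classical
  rw [coeffAt_apply, map_mul, Module.End.mul_apply, rep_sWord, opS_apply_append R X hγ.symm, rep_p,
    opP_apply_of_mem R X h, Pi.single_eq_same, mul_one]

theorem coeffAt_sWord_mul_p_eq_zero {y : X} {γ : List 𝒜} {A : U X}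
    (h : ¬(γ ++ₛ (y : Stream' 𝒜) = y ∧ y ∈ (A : Set X))) :
    coeffAt R X y (sWord R X γ * p R X A) = 0 := by
  classical
  rw [coeffAt_apply, map_mul, Module.End.mul_apply, rep_sWord, rep_p]
  by_cases hy : ∃ x, (y : Stream' 𝒜) = γ ++ₛ x
  · obtain ⟨x, hx⟩ := hy
    have hxX : x ∈ X := mem_of_append_mem (hx ▸ y.2)
    lift x to X using hxX
    rw [opS_apply_append R X hx]
    by_cases hxA : x ∈ (A : Set X)
    · rw [opP_apply_of_mem R X hxA, Pi.single_eq_of_ne, mul_zero]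
      rintro rfl
      exact h ⟨hx.symm, hxA⟩
    · rw [opP_apply_of_notMem R X hxA, mul_zero]
  · push Not at hy
    exact opS_apply_of_not R X hy _

/-- For A = {y}, p_A acts as the rank-one projection onto the delta function at y, so a matrix
coefficient factors through it. -/
theorem coeffAt_mul_p_mul {y : X} {A : U X} (h : (A : Set X) = {y})
    (a b : UnitalSubshiftAlgebra R X) :
    coeffAt R X y (a * p R X A * b) = coeffAt R X y a * coeffAt R X y b := by
  classical
  have key (f : X → R[T;T⁻¹]) : opP R X A f = f y • Pi.single y 1 := by
    funext z
    by_cases hz : z = y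
    · subst hz
      rw [opP_apply_of_mem R X (by rw [h]; rfl)]
      simp
    · rw [opP_apply_of_notMem R X (by rw [h]; exact hz)]
      simp [hz]
  simp only [coeffAt_apply, map_mul, Module.End.mul_apply, rep_p, key, map_smul, Pi.smul_apply,
    smul_eq_mul]
  exact mul_comm _ _

end Representation

/-! ### Reducing a nonzero element to a projection or to a periodic point. -/

section Reduction

variable (R : Type u) [CommRing R] {𝒜 : Type v} (X : Set (Stream' 𝒜)) [IsShiftSpace X]

local notation "S" => sWord R X
local notation "S⋆" => sStarWord R X
local notation "P" => p R X

/-- The span of the elements `s_α p_A` with `α ∈ L`. -/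
def spanSP (L : Set (List 𝒜)) : Submodule R (UnitalSubshiftAlgebra R X) :=
  Submodule.span R {z | ∃ α ∈ L, ∃ A, z = S α * P A}

/-- The span of the elements `p_A`. -/
def spanP : Submodule R (UnitalSubshiftAlgebra R X) :=
  Submodule.span R (Set.range P)

variable {R X}

omit [IsShiftSpace X] in
theorem sWord_mul_p_mem {L : Set (List 𝒜)} {α : List 𝒜} (hα : α ∈ L) (A : U X) :
    S α * P A ∈ spanSP R X L :=
  Submodule.subset_span ⟨α, hα, A, rfl⟩

omit [IsShiftSpace X] in
theorem p_mul_mem_spanP (A : U X) {d : UnitalSubshiftAlgebra R X} (hd : d ∈ spanP R X) :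
    P A * d ∈ spanP R X := by
  refine (Submodule.span_le (p := (spanP R X).comap (LinearMap.mulLeft R (P A)))).2 ?_ hd
  rintro _ ⟨B, rfl⟩
  exact Submodule.subset_span ⟨A ⊓ B, p_inf R X A B⟩

omit [IsShiftSpace X] in
theorem mul_p_mem_spanSP {L : Set (List 𝒜)} (A : U X) {n : UnitalSubshiftAlgebra R X}
    (hn : n ∈ spanSP R X L) : n * P A ∈ spanSP R X L := by
  refine (Submodule.span_le (p := (spanSP R X L).comap (LinearMap.mulRight R (P A)))).2 ?_ hn
  rintro _ ⟨γ, hγ, B, rfl⟩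
  exact Submodule.subset_span ⟨γ, hγ, B ⊓ A, by simp [p_inf, mul_assoc]⟩

theorem exists_finset_mem_span (x : UnitalSubshiftAlgebra R X) : ∃ W : Finset (List 𝒜),
    x ∈ Submodule.span R {z | ∃ α A, ∃ β ∈ W, z = S α * P A * S⋆ β} := by
  classical
  have hx : x ∈ Submodule.span R _ := span_monomial_eq_top R X ▸ Submodule.mem_top
  induction hx using Submodule.span_induction with
  | mem x h =>
    obtain ⟨⟨α, A, β⟩, rfl⟩ := h
    exact ⟨{β}, Submodule.subset_span ⟨α, A, β, by simp, rfl⟩⟩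
  | zero => exact ⟨∅, Submodule.zero_mem _⟩
  | smul c x _ ih => obtain ⟨W, h⟩ := ih; exact ⟨W, Submodule.smul_mem _ c h⟩
  | add x y _ _ hx hy =>
    obtain ⟨W, hW⟩ := hx
    obtain ⟨V, hV⟩ := hy
    refine ⟨W ∪ V, Submodule.add_mem _ (Submodule.span_mono ?_ hW) (Submodule.span_mono ?_ hV)⟩
    · rintro z ⟨α, A, β, hβ, rfl⟩
      exact ⟨α, A, β, Finset.mem_union_left _ hβ, rfl⟩
    · rintro z ⟨α, A, β, hβ, rfl⟩
      exact ⟨α, A, β, Finset.mem_union_right _ hβ, rfl⟩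

/-- Let β be a longest starred word occurring in x. If x s_β ≠ 0, then s_β absorbs every starred
word, none being longer. If x s_β = 0, then x = x(1 - s_β s_β^*), and this factor kills s_β^*
without creating new starred words, so β can be discarded. -/
theorem exists_mul_right_mem_spanSP {x : UnitalSubshiftAlgebra R X} (hx : x ≠ 0) :
    ∃ b, x * b ≠ 0 ∧ x * b ∈ spanSP R X Set.univ := by
  classical
  obtain ⟨W, hW⟩ := exists_finset_mem_span x
  induction W using Finset.induction_on_max_value (List.length (α := 𝒜)) generalizing x with
  | empty =>
    refine absurd ?_ hx
    simpa using hW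
  | insert β W _ hmax ih =>
    by_cases h : x * S β = 0
    · have h1 : x * P (push β ⊤)ᶜ = x := by
        rw [p_compl, ← sWord_mul_sStarWord, mul_sub, ← mul_assoc, h]; simp
      refine ih hx ?_
      rw [← h1]
      refine (Submodule.span_le (p := (Submodule.span R _).comap
        (LinearMap.mulRight R (P (push β ⊤)ᶜ)))).2 ?_ hW
      rintro _ ⟨α, A, β', hβ', rfl⟩
      simp only [SetLike.mem_coe, Submodule.mem_comap, LinearMap.mulRight_apply]
      rcases Finset.mem_insert.1 hβ' with rfl | hβ'
      · rw [mul_assoc, p_compl, ← sWord_mul_sStarWord, mul_sub, ← mul_assoc,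
          sStarWord_mul_sWord_mul_sStarWord]
        simp
      · rw [mul_assoc, sStarWord_mul_p, ← mul_assoc, mul_assoc (S α), ← p_inf]
        exact Submodule.subset_span ⟨α, _, β', hβ', rfl⟩
    · refine ⟨S β, h, ?_⟩
      refine (Submodule.span_le (p := (spanSP R X Set.univ).comap
        (LinearMap.mulRight R (S β)))).2 ?_ hW
      rintro _ ⟨α, A, β', hβ', rfl⟩
      simp only [SetLike.mem_coe, Submodule.mem_comap, LinearMap.mulRight_apply]
      have hl : β'.length ≤ β.length := by
        rcases Finset.mem_insert.1 hβ' with rfl | hβ'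
        exacts [le_rfl, hmax _ hβ']
      by_cases hp : ∃ γ, β = β' ++ γ
      · obtain ⟨γ, rfl⟩ := hp
        rw [mul_assoc, sStarWord_mul_sWord_append, ← mul_assoc, mul_assoc (S α), p_mul_sWord,
          ← mul_assoc, ← sWord_append, mul_assoc, ← p_inf]
        exact sWord_mul_p_mem (Set.mem_univ _) _
      · push Not at hp
        rw [mul_assoc, sStarWord_mul_sWord_eq_zero R X hl hp, mul_zero]
        exact Submodule.zero_mem _

omit [IsShiftSpace X] in
theorem exists_finset_mem_span_sWord {L : Set (List 𝒜)} {x : UnitalSubshiftAlgebra R X}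
    (hx : x ∈ spanSP R X L) : ∃ W : Finset (List 𝒜), ↑W ⊆ L ∧ x ∈ spanSP R X ↑W := by
  classical
  induction hx using Submodule.span_induction with
  | mem x h =>
    obtain ⟨α, hα, A, rfl⟩ := h
    exact ⟨{α}, by simpa using hα, sWord_mul_p_mem (by simp) A⟩
  | zero => exact ⟨∅, by simp, Submodule.zero_mem _⟩
  | smul c x _ ih => obtain ⟨W, hWL, h⟩ := ih; exact ⟨W, hWL, Submodule.smul_mem _ c h⟩
  | add x y _ _ hx hy =>
    obtain ⟨W, hWL, hW⟩ := hx
    obtain ⟨V, hVL, hV⟩ := hy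
    refine ⟨W ∪ V, by simp [hWL, hVL], Submodule.add_mem _ (Submodule.span_mono ?_ hW) (Submodule.span_mono ?_ hV)⟩
    · rintro z ⟨α, hα, A, rfl⟩
      exact ⟨α, Finset.mem_union_left _ hα, A, rfl⟩
    · rintro z ⟨α, hα, A, rfl⟩
      exact ⟨α, Finset.mem_union_right _ hα, A, rfl⟩

omit [IsShiftSpace X] in
theorem exists_eq_sWord_mul_add [DecidableEq (List 𝒜)] {α : List 𝒜} {W : Finset (List 𝒜)}
    {x : UnitalSubshiftAlgebra R X}
    (hx : x ∈ spanSP R X ↑(insert α W)) :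
    ∃ d ∈ spanP R X, ∃ x' ∈ spanSP R X ↑W, x = S α * d + x' := by
  induction hx using Submodule.span_induction with
  | mem x h =>
    obtain ⟨β, hβ, A, rfl⟩ := h
    rcases Finset.mem_insert.1 hβ with rfl | hβ
    · exact ⟨P A, Submodule.subset_span ⟨A, rfl⟩, 0, Submodule.zero_mem _, by simp⟩
    · exact ⟨0, Submodule.zero_mem _, _, Submodule.subset_span ⟨β, hβ, A, rfl⟩, by simp⟩
  | zero => exact ⟨0, Submodule.zero_mem _, 0, Submodule.zero_mem _, by simp⟩
  | smul c x _ ih =>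
    obtain ⟨d, hd, x', hx', rfl⟩ := ih
    exact ⟨c • d, Submodule.smul_mem _ c hd, c • x', Submodule.smul_mem _ c hx', by simp⟩
  | add x y _ _ hx hy =>
    obtain ⟨d, hd, x', hx', rfl⟩ := hx
    obtain ⟨e, he, y', hy', rfl⟩ := hy
    exact ⟨d + e, Submodule.add_mem _ hd he, x' + y', Submodule.add_mem _ hx' hy', by
      rw [mul_add]; abel⟩

/-- Multiply by s_α^* for a shortest word α: its own term becomes a combination of projections, and
any other s_β becomes zero or some s_γ p with γ nonempty. If the α-term vanishes under this, it was
already zero and α can be discarded. -/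
theorem exists_mul_left_eq_add {x : UnitalSubshiftAlgebra R X} (hx : x ≠ 0)
    (h : x ∈ spanSP R X Set.univ) :
    ∃ a, ∃ d ∈ spanP R X, ∃ n ∈ spanSP R X {[]}ᶜ, a * x = d + n ∧ d ≠ 0 := by
  classical
  obtain ⟨W, -, hW⟩ := exists_finset_mem_span_sWord h
  clear h
  induction W using Finset.induction_on_min_value (List.length (α := 𝒜)) generalizing x with
  | empty =>
    refine absurd ?_ hx
    simpa [spanSP] using hW
  | insert α W hα hmin ih =>
    obtain ⟨d, hd, x', hx', rfl⟩ := exists_eq_sWord_mul_add hW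
    by_cases h : S⋆ α * S α * d = 0
    · have h0 : S α * d = 0 := by
        rw [← sWord_mul_sStarWord_mul_sWord, mul_assoc (S α), mul_assoc, h, mul_zero]
      rw [h0, zero_add] at hx ⊢
      exact ih hx hx'
    · refine ⟨S⋆ α, S⋆ α * S α * d, ?_, S⋆ α * x', ?_, by rw [mul_add, mul_assoc], h⟩
      · rw [sStarWord_mul_sWord]
        exact p_mul_mem_spanP _ hd
      · refine (Submodule.span_le (p := (spanSP R X {[]}ᶜ).comap
          (LinearMap.mulLeft R (S⋆ α)))).2 ?_ hx'
        rintro _ ⟨β, hβ, A, rfl⟩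
        simp only [SetLike.mem_coe, Submodule.mem_comap, LinearMap.mulLeft_apply]
        by_cases hp : ∃ γ, β = α ++ γ
        · obtain ⟨γ, rfl⟩ := hp
          rw [← mul_assoc, sStarWord_mul_sWord_append, mul_assoc, ← p_inf]
          refine sWord_mul_p_mem ?_ _
          rintro rfl
          rw [List.append_nil] at hβ
          exact hα hβ
        · push Not at hp
          rw [← mul_assoc, sStarWord_mul_sWord_eq_zero R X (hmin _ hβ) hp, zero_mul]
          exact Submodule.zero_mem _

omit [IsShiftSpace X] in
-- Split B along A. Under A the projection p_A acts as 1 and its coefficient joins the constant e;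
-- under the complement it acts as 0. The product survives on at least one half.
theorem exists_sum_mul_p_eq_smul (c : U X → R) (s : Finset (U X)) (e : R) (B : U X)
    (h : (e • 1 + ∑ A ∈ s, c A • P A) * P B ≠ 0) :
    ∃ B' ≤ B, ∃ e' : R, (e • 1 + ∑ A ∈ s, c A • P A) * P B' = e' • P B' ∧ e' • P B' ≠ 0 := by
  classical
  induction s using Finset.induction_on generalizing e B with
  | empty =>
    refine ⟨B, le_rfl, e, by simp, ?_⟩
    simpa using h
  | insert A s hA ih =>
    rw [Finset.sum_insert hA] at h ⊢
    have h1 {B' : U X} (hB : B' ≤ A) : (e • 1 + (c A • P A + ∑ A ∈ s, c A • P A)) * P B'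
        = ((e + c A) • 1 + ∑ A ∈ s, c A • P A) * P B' := by
      have : P A * P B' = P B' := by rw [p_comm, p_mul_of_le R X hB]
      simp only [add_mul, add_smul, smul_mul_assoc, this, one_mul]
      abel
    have h2 {B' : U X} (hB : B' ≤ Aᶜ) : (e • 1 + (c A • P A + ∑ A ∈ s, c A • P A)) * P B'
        = (e • 1 + ∑ A ∈ s, c A • P A) * P B' := by
      have : P A * P B' = 0 := by
        rw [← p_inf, (le_compl_iff_disjoint_left.1 hB).eq_bot, p_bot]
      simp only [add_mul, smul_mul_assoc, this, one_mul, smul_zero, zero_add]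
    have hB : P B = P (B ⊓ A) + P (B ⊓ Aᶜ) := by
      rw [p_inf, p_inf, p_compl, mul_sub, mul_one]; abel
    by_cases hBA : (e • 1 + (c A • P A + ∑ A ∈ s, c A • P A)) * P (B ⊓ A) = 0
    · rw [hB, mul_add, hBA, zero_add, h2 inf_le_right] at h
      obtain ⟨B', hB', e', he, he'⟩ := ih _ _ h
      exact ⟨B', hB'.trans inf_le_left, e', by rw [h2 (hB'.trans inf_le_right), he], he'⟩
    · rw [h1 inf_le_right] at hBA
      obtain ⟨B', hB', e', he, he'⟩ := ih _ _ hBA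
      exact ⟨B', hB'.trans inf_le_left, e', by rw [h1 (hB'.trans inf_le_right), he], he'⟩

omit [IsShiftSpace X] in
theorem exists_mul_p_eq_smul {d : UnitalSubshiftAlgebra R X} (hd : d ∈ spanP R X) (h : d ≠ 0) :
    ∃ B : U X, ∃ e : R, d * P B = e • P B ∧ e • P B ≠ 0 := by
  obtain ⟨c, rfl⟩ := (Finsupp.mem_span_range_iff_exists_finsupp).1 hd
  have := exists_sum_mul_p_eq_smul (R := R) c c.support 0 ⊤
  simp only [zero_smul, zero_add, p_top, mul_one] at this
  obtain ⟨B, -, e, he⟩ := this h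
  exact ⟨B, e, he⟩

theorem take_append_congr {γ : List 𝒜} {x y : Stream' 𝒜} {k : ℕ} (h : x.take k = y.take k) :
    (γ ++ₛ x).take k = (γ ++ₛ y).take k := by
  have key (z : Stream' 𝒜) : (γ ++ₛ z).take k = (γ ++ z.take k).take k := by
    rw [Stream'.append_take, Stream'.take_take, min_eq_right (Nat.le_add_left _ _)]
  rw [key, key, h]

theorem exists_take_ne {γ : List 𝒜} {y : Stream' 𝒜} (h : γ ++ₛ y ≠ y) :
    ∃ k, (γ ++ₛ y).take k ≠ y.take k := by
  by_contra! hk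
  exact h (Stream'.take_theorem _ _ hk)

theorem take_eq_of_le {x y : Stream' 𝒜} {k l : ℕ} (hkl : k ≤ l) (h : x.take l = y.take l) :
    x.take k = y.take k := by
  have := congrArg (List.take k) h
  rwa [Stream'.take_take, Stream'.take_take, min_eq_right hkl] at this

theorem mem_push_take {y z : X} {k : ℕ} : z ∈ (push ((y : Stream' 𝒜).take k) (⊤ : U X) : Set X) ↔
    (z : Stream' 𝒜).take k = (y : Stream' 𝒜).take k := by
  rw [mem_push_top]
  constructor
  · rintro ⟨x, hx⟩
    have := take_append_length ((y : Stream' 𝒜).take k) x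
    rwa [← hx, Stream'.length_take] at this
  · intro h
    exact ⟨(z : Stream' 𝒜).drop k, by rw [← h, Stream'.append_take_drop]⟩

/-- A sufficiently long cylinder around y misses the finitely many other points of B. -/
theorem singleton_mem_U_of_finite {B : U X} {y : X} (hy : y ∈ (B : Set X))
    (hB : (B : Set X).Finite) : ∃ A : U X, (A : Set X) = {y} := by
  classical
  have hk (z : X) : ∃ k, z ≠ y → (z : Stream' 𝒜).take k ≠ (y : Stream' 𝒜).take k := by
    by_contra! h
    exact (h 0).1 (Subtype.ext (Stream'.take_theorem _ _ fun n => (h n).2))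
  choose k hk using hk
  refine ⟨B ⊓ push ((y : Stream' 𝒜).take (hB.toFinset.sup k)) ⊤, ?_⟩
  ext z
  rw [BooleanSubalgebra.val_inf]
  constructor
  · rintro ⟨hz, hz'⟩
    by_contra hne
    exact hk z hne (take_eq_of_le (Finset.le_sup (f := k) (hB.mem_toFinset.2 hz))
      (mem_push_take.1 hz'))
  · rintro rfl
    exact ⟨hy, mem_push_take.2 rfl⟩

/-- Each γy ≠ y is witnessed by a finite prefix. On a cylinder D around y longer than all these
prefixes no γ maps a point of D into D, so p_D s_γ p_A p_D = 0. -/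
theorem exists_p_mul_mul_p_eq_zero {n : UnitalSubshiftAlgebra R X} {Γ : Finset (List 𝒜)}
    (hn : n ∈ spanSP R X ↑Γ) {B : U X} {y : X}
    (hy : y ∈ (B : Set X)) (hΓ : ∀ γ ∈ Γ, γ ++ₛ (y : Stream' 𝒜) ≠ y) :
    ∃ D ≤ B, y ∈ (D : Set X) ∧ P D * n * P D = 0 := by
  classical
  have hk (γ : List 𝒜) : ∃ k, γ ∈ Γ → (γ ++ₛ (y : Stream' 𝒜)).take k ≠ (y : Stream' 𝒜).take k := by
    by_cases h : γ ∈ Γ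
    · obtain ⟨k, hk⟩ := exists_take_ne (hΓ γ h)
      exact ⟨k, fun _ => hk⟩
    · exact ⟨0, fun h' => absurd h' h⟩
  choose k hk using hk
  set D : U X := B ⊓ push ((y : Stream' 𝒜).take (Γ.sup k)) ⊤ with hD
  refine ⟨D, inf_le_left, ⟨hy, mem_push_take.2 rfl⟩, ?_⟩
  refine (Submodule.span_le (p := LinearMap.ker
    (LinearMap.mulRight R (P D) ∘ₗ LinearMap.mulLeft R (P D)))).2 ?_ hn
  rintro _ ⟨γ, hγ, A, rfl⟩
  simp only [SetLike.mem_coe, LinearMap.mem_ker, LinearMap.comp_apply, LinearMap.mulLeft_apply,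
    LinearMap.mulRight_apply]
  have h0 : pre γ D ⊓ D = ⊥ := by
    ext w
    refine ⟨?_, fun h => h.elim⟩
    rintro ⟨⟨z, hz, hzw⟩, hw⟩
    have h1 := mem_push_take.1 hz.2
    have h2 := mem_push_take.1 hw.2
    rw [hzw, take_append_congr h2] at h1
    exact hk γ hγ (take_eq_of_le (Finset.le_sup (f := k) hγ) h1)
  rw [← mul_assoc, p_mul_sWord, mul_assoc, mul_assoc, p_comm R X A, ← mul_assoc (P (pre γ D)),
    ← p_inf, h0, p_bot]
  simp

open LaurentPolynomial in
theorem coeffAt_coeff_zero (y : X) {n : UnitalSubshiftAlgebra R X}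
    (hn : n ∈ spanSP R X {[]}ᶜ) : (coeffAt R X y n).coeff 0 = 0 := by
  induction hn using Submodule.span_induction with
  | mem x h =>
    obtain ⟨γ, hγ, A, rfl⟩ := h
    by_cases h : γ ++ₛ (y : Stream' 𝒜) = y ∧ y ∈ (A : Set X)
    · rw [coeffAt_sWord_mul_p_of_mem R h.1 h.2, T_apply, if_neg]
      have := List.length_pos_iff.2 hγ
      omega
    · rw [coeffAt_sWord_mul_p_eq_zero R h]; rfl
  | zero => simp
  | add a b _ _ ha hb => simp [ha, hb]
  | smul c a _ ha => simp [ha]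

open LaurentPolynomial in
-- After the preceding reductions the element is c p_B + m, with m supported on a finite set Γ of
-- nonempty words. A point of B fixed by no word of Γ has a neighbourhood on which m is compressed
-- to zero. Otherwise every point of B is periodic, B is finite, and c survives as the constant
-- coefficient at a point of B.
theorem exists_mul_mul_eq_smul_p_or_periodic {x : UnitalSubshiftAlgebra R X} (hx : x ≠ 0) : ∃ a b,
    (∃ c : R, c ≠ 0 ∧ ∃ D : U X, (D : Set X).Nonempty ∧ a * x * b = c • P D) ∨
    ∃ (y : X) (A : U X) (γ : List 𝒜), (A : Set X) = {y} ∧ γ ≠ [] ∧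
      γ ++ₛ (y : Stream' 𝒜) = y ∧ P A * (a * x * b) = a * x * b ∧
      coeffAt R X y (a * x * b) ≠ 0 := by
  classical
  obtain ⟨b, hb, hb'⟩ := exists_mul_right_mem_spanSP hx
  obtain ⟨a, d, hd, n, hn, hadn, hd0⟩ := exists_mul_left_eq_add hb hb'
  obtain ⟨B, c, hc, hc0⟩ := exists_mul_p_eq_smul hd hd0
  have hc' : c ≠ 0 := by rintro rfl; simp at hc0
  set m := n * P B with hm
  have hmN : m ∈ spanSP R X {[]}ᶜ := mul_p_mem_spanSP B hn
  have hax : a * x * (b * P B) = c • P B + m := by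
    rw [hm, ← hc, ← add_mul, ← hadn]; simp only [mul_assoc]
  have hBne : (B : Set X).Nonempty := by
    by_contra h
    rw [Set.not_nonempty_iff_eq_empty] at h
    have : B = ⊥ := Subtype.ext h
    rw [this, p_bot, smul_zero] at hc0
    exact hc0 rfl
  obtain ⟨Γ, hΓ, hmΓ⟩ := exists_finset_mem_span_sWord hmN
  by_cases hy : ∃ y ∈ (B : Set X), ∀ γ ∈ Γ, γ ++ₛ (y : Stream' 𝒜) ≠ y
  · obtain ⟨y, hyB, hy⟩ := hy
    obtain ⟨D, hDB, hyD, hD⟩ := exists_p_mul_mul_p_eq_zero hmΓ hyB hy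
    refine ⟨P D * a, b * P B * P D, Or.inl ⟨c, hc', D, ⟨y, hyD⟩, ?_⟩⟩
    calc P D * a * x * (b * P B * P D) = P D * (a * x * (b * P B)) * P D := by
          simp only [mul_assoc]
      _ = c • (P D * P B * P D) + P D * m * P D := by
          rw [hax, mul_add, add_mul, mul_smul_comm, smul_mul_assoc]
      _ = c • P D := by rw [hD, p_mul_of_le R X hDB, p_mul_self, add_zero]
  · push Not at hy
    obtain ⟨y, hyB⟩ := hBne
    -- Each word of Γ fixes at most one point, so choosing a fixing word embeds B into Γ.
    have hfin : (B : Set X).Finite := by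
      choose! g hgΓ hg using hy
      refine Set.Finite.of_finite_image (f := g) (Γ.finite_toSet.subset ?_) ?_
      · rintro _ ⟨z, hz, rfl⟩
        exact hgΓ z hz
      · intro z hz w hw hzw
        exact Subtype.ext (eq_of_append_eq_self (hΓ (hgΓ z hz)) (hg z hz) (hzw ▸ hg w hw))
    obtain ⟨A, hA⟩ := singleton_mem_U_of_finite hyB hfin
    obtain ⟨γ, hγ, hγy⟩ := hy y hyB
    refine ⟨P A * a, b * P B, Or.inr ⟨y, A, γ, hA, hΓ hγ, hγy, ?_, ?_⟩⟩
    · simp only [← mul_assoc, p_mul_self]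
    · have h1 : P A * a * x * (b * P B) = P ⊤ * P A * (a * x * (b * P B)) := by
        rw [p_top]; simp only [mul_assoc, one_mul]
      rw [h1, coeffAt_mul_p_mul R hA, coeffAt_p_of_mem R (A := ⊤) (Set.mem_univ y), one_mul, hax, map_add, map_smul,
        coeffAt_p_of_mem R hyB]
      intro h
      have h2 := congrArg (fun f : R[T;T⁻¹] => f.coeff 0) h
      simp only [AddMonoidAlgebra.coeff_add, AddMonoidAlgebra.coeff_smul, Finsupp.add_apply,
        Finsupp.smul_apply, coeffAt_coeff_zero y hmN, ← T_zero, T_apply] at h2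
      exact hc' (by simpa using h2)

end Reduction

/-! ### Minimal left ideals. -/

section MinimalIdeals

/-- A nonzero right multiple of an element of a minimal left ideal generates an isomorphic
minimal left ideal. -/
theorem isAtom_span_mul_and_nonempty_equiv {B : Type*} [Ring B] {I : Ideal B} (hI : IsAtom I)
    {x : B} (hx : x ∈ I) (a b : B) (h : a * x * b ≠ 0) :
    IsAtom (Ideal.span {a * x * b}) ∧ Nonempty (I ≃ₗ[B] Ideal.span {a * x * b}) := by
  have hs : IsSimpleModule B I := isSimpleModule_iff_isAtom.2 hI
  -- Right multiplication by b on I; being nonzero on a simple module, it is injective.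
  set f : I →ₗ[B] B := (LinearMap.toSpanSingleton B B b).comp I.subtype with hf
  have hfx : f ⟨a * x, I.mul_mem_left a hx⟩ = a * x * b := rfl
  have hinj : Function.Injective f := by
    refine f.injective_or_eq_zero.resolve_right fun h0 => h ?_
    rw [← hfx, h0, LinearMap.zero_apply]
  let e : I ≃ₗ[B] LinearMap.range f := LinearEquiv.ofInjective f hinj
  have hr : IsAtom (LinearMap.range f) :=
    isSimpleModule_iff_isAtom.1 (e.isSimpleModule_iff.1 hs)
  have hle : Ideal.span {a * x * b} ≤ LinearMap.range f := by
    rw [Ideal.span_le, Set.singleton_subset_iff]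
    exact ⟨_, hfx⟩
  have heq : Ideal.span {a * x * b} = LinearMap.range f :=
    (hr.le_iff.1 hle).resolve_left fun h0 => h (Ideal.span_singleton_eq_bot.1 h0)
  refine ⟨by rw [heq]; exact hr, ⟨e.trans (LinearEquiv.ofEq _ _ heq.symm)⟩⟩

theorem isAtom_of_linearEquiv {B : Type*} [Ring B] {I J : Ideal B} (e : I ≃ₗ[B] J)
    (hJ : IsAtom J) : IsAtom I :=
  isSimpleModule_iff_isAtom.1 (e.isSimpleModule_iff.2 (isSimpleModule_iff_isAtom.2 hJ))

variable {R : Type u} [Field R] {𝒜 : Type v} {X : Set (Stream' 𝒜)} [IsShiftSpace X]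

local notation "S" => sWord R X
local notation "S⋆" => sStarWord R X
local notation "P" => p R X

open LaurentPolynomial in
-- The element p_A(1 - s_γ)f generates a nonzero smaller ideal: its coefficient is that of f times 1
-- - T^|γ|, which is nonzero but not a unit.
theorem not_isAtom_span_of_periodic {y : X} {A : U X} {γ : List 𝒜} (hA : (A : Set X) = {y})
    (hγ : γ ≠ []) (hγy : γ ++ₛ (y : Stream' 𝒜) = y) {f : UnitalSubshiftAlgebra R X}
    (hf : P A * f = f) (hf0 : coeffAt R X y f ≠ 0) :
    ¬IsAtom (Ideal.span {f}) := by
  intro hat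
  have htop : y ∈ ((⊤ : U X) : Set X) := Set.mem_univ y
  have h1 : coeffAt R X y (1 - S γ) = 1 - T γ.length := by
    have e1 : coeffAt R X y 1 = 1 := by rw [← p_top, coeffAt_p_of_mem R htop]
    have e2 : coeffAt R X y (S γ) = T γ.length := by
      rw [← mul_one (S γ), ← p_top, coeffAt_sWord_mul_p_of_mem R hγy htop]
    rw [map_sub, e1, e2]
  have key (z : UnitalSubshiftAlgebra R X) : coeffAt R X y (z * (P A * ((1 - S γ) * f)))
      = coeffAt R X y z * ((1 - T γ.length) * coeffAt R X y f) := by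
    rw [← mul_assoc, coeffAt_mul_p_mul R hA, ← h1, ← coeffAt_mul_p_mul R hA (1 - S γ) f,
      mul_assoc (1 - S γ), hf]
  have hne : (1 - T γ.length : R[T;T⁻¹]) ≠ 0 := by
    intro h
    have h2 := congrArg (fun f : R[T;T⁻¹] => f.coeff 0) h
    have h3 := List.length_pos_iff.2 hγ
    simp [← LaurentPolynomial.T_zero, h3.ne'] at h2
  set g := P A * ((1 - S γ) * f) with hg
  have hg0 : g ≠ 0 := by
    intro h0
    have h2 := key 1
    rw [h0, mul_zero, map_zero, ← p_top, coeffAt_p_of_mem R htop, one_mul] at h2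
    exact mul_ne_zero hne hf0 h2.symm
  have hle : Ideal.span {g} ≤ Ideal.span {f} := by
    rw [Ideal.span_le, Set.singleton_subset_iff]
    exact Ideal.mul_mem_left _ _ (Ideal.mul_mem_left _ _ (Ideal.mem_span_singleton_self f))
  have heq : Ideal.span {g} = Ideal.span {f} :=
    (hat.le_iff.1 hle).resolve_left fun h0 => hg0 (Ideal.span_singleton_eq_bot.1 h0)
  have hfg : f ∈ Ideal.span {g} := heq ▸ Ideal.mem_span_singleton_self f
  obtain ⟨z, hz⟩ := Ideal.mem_span_singleton'.1 hfg
  have h2 := key z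
  rw [hz, ← mul_assoc] at h2
  have h3 : coeffAt R X y z * (1 - T γ.length) = 1 :=
    mul_right_cancel₀ hf0 (by rw [one_mul]; exact h2.symm)
  -- At T = 1 the left side vanishes, giving 0 = 1.
  have h4 := congrArg (eval₂ (RingHom.id R) 1) h3
  rw [map_mul, map_sub, eval₂_T_n] at h4
  simp at h4

theorem eq_singleton_of_isAtom {D : U X} {y : X} (hy : y ∈ (D : Set X))
    (hD : IsAtom (Ideal.span {P D})) : (D : Set X) = {y} := by
  refine Set.eq_singleton_iff_unique_mem.2 ⟨hy, fun z hz => ?_⟩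
  by_contra hzy
  obtain ⟨k, hk⟩ : ∃ k, (z : Stream' 𝒜).take k ≠ (y : Stream' 𝒜).take k := by
    by_contra! h
    exact hzy (Subtype.ext (Stream'.take_theorem _ _ h))
  set B : U X := D ⊓ push ((y : Stream' 𝒜).take k) ⊤ with hB
  have hB0 : P B ≠ 0 := p_ne_zero R (y := y) ⟨hy, mem_push_take.2 rfl⟩
  have hle : Ideal.span {P B} ≤ Ideal.span {P D} := by
    rw [Ideal.span_le, Set.singleton_subset_iff, ← p_mul_of_le R X (inf_le_left : B ≤ D)]
    exact Ideal.mul_mem_left _ _ (Ideal.mem_span_singleton_self _)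
  have heq := (hD.le_iff.1 hle).resolve_left fun h0 => hB0 (Ideal.span_singleton_eq_bot.1 h0)
  have hDB : P D ∈ Ideal.span {P B} := heq ▸ Ideal.mem_span_singleton_self _
  obtain ⟨w, hw⟩ := Ideal.mem_span_singleton'.1 hDB
  have h1 : P (D ⊓ Bᶜ) = 0 := by
    rw [p_inf, p_compl, ← hw, mul_sub, mul_one, mul_assoc, p_mul_self, sub_self]
  exact p_ne_zero R (y := z) (A := D ⊓ Bᶜ) ⟨hz, fun h => hk (mem_push_take.1 h.2)⟩ h1

theorem exists_irrationalPaths_of_isAtom {I : Ideal (UnitalSubshiftAlgebra R X)} (hI : IsAtom I) :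
    ∃ A ∈ irrationalPaths X,
      Nonempty (I ≃ₗ[UnitalSubshiftAlgebra R X] Ideal.span {P A}) := by
  obtain ⟨x, hxI, hx⟩ := Submodule.exists_mem_ne_zero_of_ne_bot hI.1
  obtain ⟨a, b, ⟨c, hc, D, ⟨y, hy⟩, h⟩ | ⟨y, A, γ, hA, hγ, hγy, hf, hf0⟩⟩ :=
    exists_mul_mul_eq_smul_p_or_periodic hx
  · have h' : (c⁻¹ • a) * x * b = P D := by
      rw [smul_mul_assoc, smul_mul_assoc, h, smul_smul, inv_mul_cancel₀ hc, one_smul]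
    obtain ⟨hat, e⟩ := isAtom_span_mul_and_nonempty_equiv hI hxI (c⁻¹ • a) b
      (by rw [h']; exact p_ne_zero R hy)
    rw [h'] at hat e
    have hD := eq_singleton_of_isAtom hy hat
    refine ⟨D, ⟨y, hD, fun α _ β _ hβ hyβ => ?_⟩, e⟩
    have hmem : Stream'.cycle β hβ ∈ X := mem_of_append_mem (hyβ ▸ y.2)
    -- Removing the prefix α turns an eventually periodic point into a periodic one; algebraically,
    -- s_α^* p_D s_α is the projection of {β^∞}.
    have hpre : (pre α D : Set X) = {⟨_, hmem⟩} := by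
      ext z
      rw [mem_pre, hD]
      constructor
      · rintro ⟨w, rfl, hw⟩
        rw [hyβ] at hw
        exact Subtype.ext (Stream'.append_right_injective _ _ _ hw).symm
      · rintro rfl
        exact ⟨y, rfl, hyβ⟩
    have h1 := sStarWord_mul_p_mul_sWord R X α D
    have hmem' : (⟨_, hmem⟩ : X) ∈ (pre α D : Set X) := by rw [hpre]; rfl
    obtain ⟨hat', -⟩ := isAtom_span_mul_and_nonempty_equiv hat
      (Ideal.mem_span_singleton_self (P D)) (S⋆ α) (S α) (by rw [h1]; exact p_ne_zero R hmem')
    rw [h1] at hat'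
    refine not_isAtom_span_of_periodic hpre hβ (Stream'.cycle_eq β hβ).symm (p_mul_self R X _) ?_
      hat'
    rw [coeffAt_p_of_mem R hmem']
    exact one_ne_zero
  · refine absurd (isAtom_span_mul_and_nonempty_equiv hI hxI a b ?_).1
      (not_isAtom_span_of_periodic hA hγ hγy hf hf0)
    intro h0
    rw [h0, map_zero] at hf0
    exact hf0 rfl

/-- It suffices that some axb has nonzero square: p_D is idempotent, and in the periodic case the
coefficient of the square is a square in the domain R[T;T⁻¹]. -/
theorem exists_mul_mul_ne_zero {x : UnitalSubshiftAlgebra R X} (hx : x ≠ 0) :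
    ∃ w, x * w * x ≠ 0 := by
  suffices h : ∃ a b, (a * x * b) * (a * x * b) ≠ 0 by
    obtain ⟨a, b, h⟩ := h
    refine ⟨b * a, fun h0 => h ?_⟩
    calc (a * x * b) * (a * x * b) = a * (x * (b * a) * x) * b := by simp only [mul_assoc]
      _ = 0 := by rw [h0]; simp
  obtain ⟨a, b, ⟨c, hc, D, ⟨y, hy⟩, h⟩ | ⟨y, A, γ, hA, -, -, hf, hf0⟩⟩ :=
    exists_mul_mul_eq_smul_p_or_periodic hx
  · refine ⟨a, b, ?_⟩
    rw [h, smul_mul_smul_comm, p_mul_self]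
    exact smul_ne_zero (mul_ne_zero hc hc) (p_ne_zero R hy)
  · refine ⟨a, b, fun h0 => ?_⟩
    have h1 := coeffAt_mul_p_mul R hA (a * x * b) (a * x * b)
    rw [mul_assoc _ (P A), hf, h0, map_zero] at h1
    exact mul_ne_zero hf0 hf0 h1.symm

theorem exists_eq_append_cycle {y : X} {α β : List 𝒜} {x : Stream' 𝒜}
    (hα : (y : Stream' 𝒜) = α ++ₛ x) (hβ : (y : Stream' 𝒜) = β ++ₛ x)
    (hl : α.length < β.length) :
    ∃ γ ∈ language X, ∃ hγ : γ ≠ [], α ∈ language X ∧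
      (y : Stream' 𝒜) = α ++ₛ Stream'.cycle γ hγ := by
  obtain ⟨γ, rfl, hx⟩ := append_eq_append_of_length_le (hα.symm.trans hβ) hl.le
  have hγ : γ ≠ [] := by rintro rfl; simp at hl
  have hyX : α ++ₛ x ∈ X := hα ▸ y.2
  refine ⟨γ, mem_language_iff.2 ⟨x, hx ▸ mem_of_append_mem hyX⟩, hγ,
    mem_language_iff.2 ⟨x, hyX⟩, ?_⟩
  rw [hα, eq_of_append_eq_self hγ hx.symm (Stream'.cycle_eq γ hγ).symm]

/-- A monomial s_α p_B s_β^* survives compression only if y = αx = βx for some x. Words of different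
lengths would make x periodic, so α = β and the compression is p_A itself. -/
theorem p_mul_mul_p_eq_smul {A : U X} (hA : A ∈ irrationalPaths X)
    (x : UnitalSubshiftAlgebra R X) : ∃ c : R, P A * x * P A = c • P A := by
  obtain ⟨y, hAy, hirr⟩ := hA
  have hx : x ∈ Submodule.span R _ := span_monomial_eq_top R X ▸ Submodule.mem_top
  induction hx using Submodule.span_induction with
  | mem x h =>
    obtain ⟨⟨α, B, β⟩, rfl⟩ := h
    set E := pre α A ⊓ B ⊓ pre β A with hE
    have h1 : P A * (S α * P B * S⋆ β) * P A = S α * P E * S⋆ β := by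
      calc P A * (S α * P B * S⋆ β) * P A = (P A * S α) * P B * (S⋆ β * P A) := by
            simp only [mul_assoc]
        _ = _ := by
          rw [p_mul_sWord, sStarWord_mul_p, hE, p_inf, p_inf]; simp only [mul_assoc]
    simp only [h1]
    rcases (E : Set X).eq_empty_or_nonempty with hE0 | ⟨x, hxE⟩
    · refine ⟨0, ?_⟩
      rw [show E = ⊥ from Subtype.ext hE0, p_bot]; simp
    · obtain ⟨⟨⟨z, hz, hα⟩, -⟩, ⟨z', hz', hβ⟩⟩ := id hxE
      rw [hAy] at hz hz'
      obtain rfl : z = y := hz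
      obtain rfl : z' = z := hz'
      have hαβ : α = β := by
        rcases lt_trichotomy α.length β.length with h | h | h
        · obtain ⟨γ, hγL, hγ, hαL, h⟩ := exists_eq_append_cycle hα hβ h
          exact absurd h (hirr α hαL γ hγL hγ)
        · exact Stream'.append_left_injective _ _ _ _ (hα.symm.trans hβ) h
        · obtain ⟨γ, hγL, hγ, hβL, h⟩ := exists_eq_append_cycle hβ hα h
          exact absurd h (hirr β hβL γ hγL hγ)
      subst hαβ
      refine ⟨1, ?_⟩
      rw [sWord_mul_p_mul_sStarWord, one_smul]
      congr 1
      refine Subtype.ext ?_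
      rw [hAy]
      ext w
      constructor
      · rintro ⟨x', hx', hw⟩
        obtain ⟨v, hv, hv'⟩ := hx'.1.1
        rw [hAy] at hv
        obtain rfl : v = z' := hv
        exact Subtype.ext (hw.trans hv'.symm)
      · rintro rfl
        exact ⟨x, hxE, hα⟩
  | zero => exact ⟨0, by simp⟩
  | add a b _ _ ha hb =>
    obtain ⟨c, hc⟩ := ha
    obtain ⟨d, hd⟩ := hb
    exact ⟨c + d, by rw [mul_add, add_mul, hc, hd, add_smul]⟩
  | smul c a _ ha =>
    obtain ⟨d, hd⟩ := ha
    exact ⟨c * d, by rw [mul_smul_comm, smul_mul_assoc, hd, smul_smul]⟩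

theorem isAtom_span_of_mem_irrationalPaths {A : U X} (hA : A ∈ irrationalPaths X) :
    IsAtom (Ideal.span {P A}) := by
  obtain ⟨y, hAy, -⟩ := id hA
  have hA0 : P A ≠ 0 := p_ne_zero R (y := y) (by rw [hAy]; rfl)
  refine ⟨fun h => hA0 (Ideal.span_singleton_eq_bot.1 h), fun J hJ => ?_⟩
  by_contra hJ0
  obtain ⟨x, hxJ, hx⟩ := Submodule.exists_mem_ne_zero_of_ne_bot hJ0
  have hxA : x * P A = x := by
    obtain ⟨w, rfl⟩ := Ideal.mem_span_singleton'.1 (hJ.le hxJ)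
    rw [mul_assoc, p_mul_self]
  -- As x = x p_A, the element p_A w x lies in the corner, so it is c p_A. Moreover x w x = x(p_A w
  -- x) ≠ 0 forces c ≠ 0.
  obtain ⟨w, hw⟩ := exists_mul_mul_ne_zero hx
  obtain ⟨c, hc⟩ := p_mul_mul_p_eq_smul (R := R) hA (w * x)
  have hc' : P A * (w * x) = c • P A := by rw [← hc, mul_assoc, mul_assoc, hxA]
  have hc0 : c ≠ 0 := by
    rintro rfl
    rw [zero_smul] at hc'
    refine hw ?_
    rw [← hxA, mul_assoc, mul_assoc, ← mul_assoc w, ← mul_assoc (P A), hc', zero_mul, mul_zero]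
  refine hJ.not_ge ?_
  rw [Ideal.span_le, Set.singleton_subset_iff]
  have h1 : P A = (c⁻¹ • (P A * w)) * x := by
    rw [smul_mul_assoc, mul_assoc, hc', smul_smul, inv_mul_cancel₀ hc0, one_smul]
  rw [h1]
  exact J.mul_mem_left _ hxJ

end MinimalIdeals

end SubshiftAlgebra

theorem mainTheorem3 {R : Type*} [Field R] {𝒜 : Type*} (F : Set (List 𝒜))
    (hF : ∀ a : 𝒜, [a] ∈ SubshiftAlgebra.language (SubshiftAlgebra.subshift F))
    (I : Ideal (SubshiftAlgebra.UnitalSubshiftAlgebra R (SubshiftAlgebra.subshift F))) :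
    IsAtom I ↔
      ∃ A ∈ SubshiftAlgebra.irrationalPaths (SubshiftAlgebra.subshift F),
        Nonempty
          (I ≃ₗ[SubshiftAlgebra.UnitalSubshiftAlgebra R (SubshiftAlgebra.subshift F)]
            Ideal.span {SubshiftAlgebra.p R (SubshiftAlgebra.subshift F) A}) := by
  have := SubshiftAlgebra.subshift_isShiftSpace F hF
  refine ⟨SubshiftAlgebra.exists_irrationalPaths_of_isAtom, fun ⟨A, hA, ⟨e⟩⟩ => ?_⟩
  exact SubshiftAlgebra.isAtom_of_linearEquiv e
    (SubshiftAlgebra.isAtom_span_of_mem_irrationalPaths hA)
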